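/- Let $m\ge 0$ and let $\mathcal H=\ell^2(\mathbb N^m)$ be the Hilbert space of $m$ bosonic modes, with number states $|k\rangle$, $k\in\mathbb N^m$, and coherent states $|\alpha\rangle=e^{-\|\alpha\|^2/2}\sum_{k}\bigl(\prod_i \alpha_i^{k_i}/\sqrt{k_i!}\bigr)|k\rangle$, $\alpha\in\mathbb C^m$. The Bargmann function (in type-wise order, bra variables $w$ before ket variables $z$) of a bounded operator $\rho$ on $\mathcal H$ is $$F_\rho(w,z)=e^{\frac{\|w\|^2+\|z\|^2}{2}}\langle \bar z|\rho|w\rangle,\qquad w,z\in\mathbb C^m .$$ Let $\Lambda,\Gamma\in\mathbb C^{m\times m}$ with $\Lambda=\Lambda^{\mathrm T}$, let $b\in\mathbb C^{2m}$, $c\in\mathbb C$, and put $$A=\begin{bmatrix}\Lambda^\dagger&\Gamma\\ \Gamma^{\mathrm T}&\Lambda\end{bmatrix},\qquad X=\begin{bmatrix}0&\mathbb 1\\ \mathbb 1&0\end{bmatrix},\qquad F(\zeta)=c\,\exp\bigl(\tfrac12\zeta^{\mathrm T}A\zeta+\zeta^{\mathrm T}b\bigr),\quad \zeta=\begin{bmatrix}w\\z\end{bmatrix}\in\mathbb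 C^{2m}.$$ Then the Gaussian function $F$ is the Bargmann function of a density operator (a positive semi-definite operator $\rho$ on $\mathcal H$ with $\operatorname{tr}\rho=1$) if and only if $b=\begin{bmatrix}\bar\beta\\ \beta\end{bmatrix}$ for some $\beta\in\mathbb C^m$ and the following three conditions hold: 1. $0\le\Gamma<\mathbb 1$; 2. $\Lambda^\dagger(\mathbb 1-\Gamma^{\mathrm T})^{-1}\Lambda<\mathbb 1-\Gamma$; 3. $c=\sqrt{\det(\mathbb 1-XA)}\;\exp\bigl(-\tfrac12\, b^{\mathrm T}(\mathbb 1-XA)^{-1}\bar b\bigr)$. Here $P\ge0$ (resp. $P>0$) means that $P$ is Hermitian and positive semi-definite (resp. positive definite), and $P<Q$ means $Q-P>0$. -/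

import Mathlib

open scoped Matrix ComplexOrder

noncomputable section

namespace BosonicModes

/-- The Hilbert space of `m` bosonic modes, in the number representation: square-summable families
of amplitudes indexed by the occupation numbers `k = (k₁, …, k_m)`. -/
abbrev Fock (m : ℕ) : Type := lp (fun _ : Fin m → ℕ => ℂ) 2

/-- The number state `|k⟩`. -/
def numberState {m : ℕ} (k : Fin m → ℕ) : Fock m := lp.single 2 k (1 : ℂ)

/-- The squared Euclidean norm `‖z‖² = ∑ i, |z i|²` of a vector of `ℂᵐ`. -/
def sqNorm {m : ℕ} (z : Fin m → ℂ) : ℝ := ∑ i, ‖z i‖ ^ 2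

/-- The amplitude `⟨k|α⟩ = exp (-‖α‖² / 2) ∏ i, α i ^ k i / √(k i)!` of the coherent state. -/
def coherentCoeff {m : ℕ} (α : Fin m → ℂ) (k : Fin m → ℕ) : ℂ :=
  (Real.exp (-(sqNorm α) / 2) : ℂ) *
    ∏ i, α i ^ k i / (Real.sqrt ((k i).factorial : ℝ) : ℂ)

theorem memlp_coherentCoeff {m : ℕ} (α : Fin m → ℂ) :
    Memℓp (coherentCoeff α) 2 := by
  have hsq : ∀ k : Fin m → ℕ, ‖coherentCoeff α k‖ ^ 2 =
      Real.exp (-(sqNorm α) / 2) ^ 2 *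
        ∏ i, ((‖α i‖ ^ 2) ^ k i / ((k i).factorial : ℝ)) := by
    intro k
    rw [coherentCoeff, norm_mul, mul_pow, norm_prod, ← Finset.prod_pow]
    congr 1
    · rw [Complex.norm_real, Real.norm_eq_abs, sq_abs]
    · refine Finset.prod_congr rfl fun i _ => ?_
      rw [norm_div, norm_pow, div_pow, Complex.norm_real, Real.norm_eq_abs, sq_abs,
        Real.sq_sqrt (Nat.cast_nonneg _), ← pow_mul, ← pow_mul, mul_comm]
  refine memℓp_gen ?_
  have h2 : (2 : ENNReal).toReal = ((2 : ℕ) : ℝ) := by norm_num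
  simp only [h2, Real.rpow_natCast, hsq]
  refine Summable.mul_left _ ?_
  refine summable_of_sum_le (c := ∏ i, Real.exp (‖α i‖ ^ 2)) (fun k => by positivity) ?_
  intro s
  obtain ⟨N, hN⟩ : ∃ N : ℕ, ∀ k ∈ s, ∀ i, k i < N := by
    refine ⟨(s.sup fun k => Finset.univ.sup k) + 1, fun k hk i => ?_⟩
    have h1 : k i ≤ Finset.univ.sup k := Finset.le_sup (f := k) (Finset.mem_univ i)
    have h3 : Finset.univ.sup k ≤ s.sup fun k => Finset.univ.sup k :=
      Finset.le_sup (f := fun k : Fin m → ℕ => Finset.univ.sup k) hk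
    omega
  have hsub : s ⊆ Fintype.piFinset fun _ : Fin m => Finset.range N := by
    intro k hk
    simp only [Fintype.mem_piFinset, Finset.mem_range]
    exact hN k hk
  calc ∑ k ∈ s, ∏ i, ((‖α i‖ ^ 2) ^ k i / ((k i).factorial : ℝ))
      ≤ ∑ k ∈ Fintype.piFinset fun _ : Fin m => Finset.range N,
          ∏ i, ((‖α i‖ ^ 2) ^ k i / ((k i).factorial : ℝ)) :=
        Finset.sum_le_sum_of_subset_of_nonneg hsub fun k _ _ => by positivity
    _ = ∏ i, ∑ j ∈ Finset.range N, (‖α i‖ ^ 2) ^ j / (j.factorial : ℝ) :=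
        (Finset.prod_univ_sum (fun _ : Fin m => Finset.range N)
          (fun i j => (‖α i‖ ^ 2) ^ j / (j.factorial : ℝ))).symm
    _ ≤ ∏ i, Real.exp (‖α i‖ ^ 2) :=
        Finset.prod_le_prod (fun i _ => Finset.sum_nonneg fun j _ => by positivity)
          (fun i _ => Real.sum_le_exp_of_nonneg (by positivity) N)

/-- The (normalized) coherent state `|α⟩`. -/
def coherentState {m : ℕ} (α : Fin m → ℂ) : Fock m := ⟨coherentCoeff α, memlp_coherentCoeff α⟩

/-- A density operator: positive semi-definite with trace one. The trace of a positive operator is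
the sum of its diagonal matrix elements in an orthonormal basis (here the number basis); that this
sum converges is trace-class membership. -/
structure IsDensityOperator {m : ℕ} (ρ : Fock m →L[ℂ] Fock m) : Prop where
  isPositive : ρ.IsPositive
  hasSum_trace : HasSum (fun k => inner ℂ (numberState k) (ρ (numberState k))) 1

/-- The Bargmann function of an operator in type-wise order, the bra variables `w` first and the
ket variables `z` second: `F_ρ(w, z) = exp ((‖w‖² + ‖z‖²) / 2) ⟨z*| ρ |w⟩`. -/
def bargmann {m : ℕ} (ρ : Fock m →L[ℂ] Fock m) (ζ : Fin m ⊕ Fin m → ℂ) : ℂ :=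
  (Real.exp ((sqNorm (ζ ∘ Sum.inl) + sqNorm (ζ ∘ Sum.inr)) / 2) : ℂ) *
    inner ℂ (coherentState (star (ζ ∘ Sum.inr))) (ρ (coherentState (ζ ∘ Sum.inl)))

/-- The Gaussian function `c exp (½ ζᵀ A ζ + ζᵀ b)`. -/
def gaussianFn {m : ℕ} (A : Matrix (Fin m ⊕ Fin m) (Fin m ⊕ Fin m) ℂ) (b : Fin m ⊕ Fin m → ℂ)
    (c : ℂ) (ζ : Fin m ⊕ Fin m → ℂ) : ℂ :=
  c * Complex.exp (1 / 2 * (ζ ⬝ᵥ (A *ᵥ ζ)) + ζ ⬝ᵥ b)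

/-- `F` represents a density operator: it is the Bargmann function of one. -/
def RepresentsDensityOperator {m : ℕ} (F : (Fin m ⊕ Fin m → ℂ) → ℂ) : Prop :=
  ∃ ρ : Fock m →L[ℂ] Fock m, IsDensityOperator ρ ∧ bargmann ρ = F

/-- The matrix `A` in type-wise order with blocks `Λ†, Γ, Γᵀ, Λ`. -/
def typeWiseA {m : ℕ} (Λ Γ : Matrix (Fin m) (Fin m) ℂ) :
    Matrix (Fin m ⊕ Fin m) (Fin m ⊕ Fin m) ℂ :=
  Matrix.fromBlocks Λᴴ Γ Γᵀ Λ

/-- The block swap `X`. -/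
def swapX (m : ℕ) : Matrix (Fin m ⊕ Fin m) (Fin m ⊕ Fin m) ℂ :=
  Matrix.fromBlocks 0 1 1 0

end BosonicModes

end

open scoped Matrix ComplexOrder

noncomputable section

/-! Everything rests on the Husimi integral `∫ F(z, z̄) exp(-‖z‖²) = πᵐ tr ρ`
(`IsDensityOperator.lintegral_bargmann`). For Gaussian `F` with Γ Hermitian and `b = (β̄, β)`, put
`z = q + ip`. The exponent becomes `-xᵀSx + lᵀx` with `S = ½ U†(1 - XA)U` real, where `U` sends `(q,
p)` to `(z, z̄)`. A finite integral forces `S > 0`, that is `1 - XA > 0`; by a Schur complement this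
says `1 - Γ > 0` together with condition 2. The value of the integral then fixes `c`.

Necessity: `F(0) = c ≥ 0` by positivity, and `c ≠ 0` because the integral is nonzero.
Self-adjointness of ρ gives `conj F(w, z) = F(z̄, w̄)`, hence the shape of `b` and `Γ = Γ†`
(`hermitian_of_representsDensityOperator`). Cauchy-Schwarz against the vacuum gives `exp(x†Γx) ≥ 1`,
hence `Γ ≥ 0` (`posSemidef_of_representsDensityOperator`).

Sufficiency: write `Γ = B†B` and expand `exp(wᵀΓz)` as an exponential series in the products `(Bz)ᵢ
conj((Bw̄)ᵢ)`. This gives `F(w, z) = ∑ₗ gₗ(z) conj(gₗ(w̄))` with entire `gₗ` (`hasSum_pureFactor`).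
Their Gaussian square norms add up to the Husimi integral, which condition 3 makes equal to `πᵐ`. So
the `gₗ` come from vectors `φₗ` with `∑ ‖φₗ‖² = 1`, and `ρ = ∑ₗ |φₗ⟩⟨φₗ|` is the required state. -/

/-- Positive definite means positive semi-definite and invertible; once `A` is invertible, both
properties pass between the block matrix and its Schur complement. -/
theorem Matrix.posDef_fromBlocks_iff {n p : Type*} [Fintype n] [DecidableEq n] [Fintype p]
    [DecidableEq p] {A : Matrix n n ℂ} {B : Matrix n p ℂ} {D : Matrix p p ℂ} :
    (Matrix.fromBlocks A B Bᴴ D).PosDef ↔ A.PosDef ∧ (D - Bᴴ * A⁻¹ * B).PosDef := by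
  have key : A.PosDef → ((Matrix.fromBlocks A B Bᴴ D).PosDef ↔ (D - Bᴴ * A⁻¹ * B).PosDef) := by
    intro hA
    have : Invertible A := hA.isUnit.invertible
    have h1 := Matrix.PosDef.fromBlocks₁₁ B D hA
    have h2 := Matrix.isUnit_fromBlocks_iff_of_invertible₁₁ (A := A) (B := B) (C := Bᴴ) (D := D)
    rw [Matrix.invOf_eq_nonsing_inv] at h2
    exact ⟨fun h => (h1.1 h.posSemidef).posDef_iff_isUnit.2 (h2.1 h.isUnit),
      fun h => (h1.2 h.posSemidef).posDef_iff_isUnit.2 (h2.2 h.isUnit)⟩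
  constructor
  · intro h
    have hA : A.PosDef := h.submatrix (e := Sum.inl) Sum.inl_injective
    exact ⟨hA, (key hA).1 h⟩
  · rintro ⟨hA, h⟩
    exact (key hA).2 h

namespace BosonicModes

open Filter Topology MeasureTheory ComplexConjugate

/-! ### Absolutely convergent series over multi-indices -/

section PiSeries

variable {ι : Type*} [Fintype ι]

/-- Cubes are cofinal among finite sets of multi-indices, and over a cube a sum of products factors
into a product of sums. -/
theorem tendsto_piFinset_range [DecidableEq ι] :
    Tendsto (fun N : ℕ => Fintype.piFinset fun _ : ι => Finset.range N) atTop atTop := by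
  refine tendsto_atTop.2 fun s => ?_
  filter_upwards [eventually_ge_atTop ((s.sup fun k => Finset.univ.sup k) + 1)] with N hN
  intro k hk
  simp only [Fintype.mem_piFinset, Finset.mem_range]
  intro i
  have h1 : k i ≤ Finset.univ.sup k := Finset.le_sup (f := k) (Finset.mem_univ i)
  have h2 : Finset.univ.sup k ≤ s.sup fun k => Finset.univ.sup k :=
    Finset.le_sup (f := fun k : ι → ℕ => Finset.univ.sup k) hk
  omega

/-- A product of absolutely convergent series, indexed by multi-indices, converges absolutely. -/
theorem summable_norm_prod_pi {𝕜 : Type*} [NormedField 𝕜] {f : ι → ℕ → 𝕜}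
    (hf : ∀ i, Summable fun n => ‖f i n‖) :
    Summable fun k : ι → ℕ => ‖∏ i, f i (k i)‖ := by
  classical
  refine summable_of_sum_le (c := ∏ i, ∑' n, ‖f i n‖) (fun k => norm_nonneg _) fun s => ?_
  obtain ⟨N, hN⟩ := (tendsto_atTop.1 (tendsto_piFinset_range (ι := ι)) s).exists
  calc ∑ k ∈ s, ‖∏ i, f i (k i)‖
      ≤ ∑ k ∈ Fintype.piFinset fun _ : ι => Finset.range N, ‖∏ i, f i (k i)‖ :=
        Finset.sum_le_sum_of_subset_of_nonneg hN fun k _ _ => norm_nonneg _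
    _ = ∏ i, ∑ n ∈ Finset.range N, ‖f i n‖ := by
        simp_rw [norm_prod]
        exact (Finset.prod_univ_sum (fun _ : ι => Finset.range N) (fun i n => ‖f i n‖)).symm
    _ ≤ ∏ i, ∑' n, ‖f i n‖ :=
        Finset.prod_le_prod (fun i _ => Finset.sum_nonneg fun n _ => norm_nonneg _)
          (fun i _ => (hf i).sum_le_tsum _ fun n _ => norm_nonneg _)

theorem hasSum_prod_pi {𝕜 : Type*} [NormedField 𝕜] [CompleteSpace 𝕜] {f : ι → ℕ → 𝕜} {s : ι → 𝕜}
    (hf : ∀ i, Summable fun n => ‖f i n‖) (hs : ∀ i, HasSum (f i) (s i)) :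
    HasSum (fun k : ι → ℕ => ∏ i, f i (k i)) (∏ i, s i) := by
  classical
  have h := (summable_norm_prod_pi hf).of_norm.hasSum
  have h0 : Tendsto (fun t : Finset (ι → ℕ) => ∑ k ∈ t, ∏ i, f i (k i)) atTop
      (𝓝 (∑' k : ι → ℕ, ∏ i, f i (k i))) := by
    simpa [HasSum] using h
  have h1 : Tendsto (fun N : ℕ => ∑ k ∈ Fintype.piFinset fun _ : ι => Finset.range N,
      ∏ i, f i (k i)) atTop (𝓝 (∑' k : ι → ℕ, ∏ i, f i (k i))) :=
    h0.comp (tendsto_piFinset_range (ι := ι))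
  have h2 : Tendsto (fun N : ℕ => ∏ i, ∑ n ∈ Finset.range N, f i n) atTop (𝓝 (∏ i, s i)) :=
    tendsto_finsetProd _ fun i _ => (hs i).tendsto_sum_nat
  have h3 : ∀ N : ℕ, ∏ i, ∑ n ∈ Finset.range N, f i n =
      ∑ k ∈ Fintype.piFinset fun _ : ι => Finset.range N, ∏ i, f i (k i) := fun N =>
    Finset.prod_univ_sum (fun _ : ι => Finset.range N) (fun i n => f i n)
  simp only [h3] at h2
  have h4 := tendsto_nhds_unique h1 h2
  rwa [h4] at h

/-- The exponential series in several variables. -/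
theorem hasSum_prod_pow_div_factorial (x : ι → ℂ) :
    HasSum (fun k : ι → ℕ => ∏ i, x i ^ k i / ((k i).factorial : ℂ)) (Complex.exp (∑ i, x i)) := by
  rw [Complex.exp_sum]
  refine hasSum_prod_pi (f := fun i n => x i ^ n / (n.factorial : ℂ)) (fun i => ?_) fun i => ?_
  · simpa using NormedSpace.norm_expSeries_div_summable (𝔸 := ℂ) (x i)
  · rw [Complex.exp_eq_exp_ℂ]
    exact NormedSpace.expSeries_div_hasSum_exp (x i)

/-- The weighted inequality `a ≤ 2ⁿ a² + 2⁻ⁿ`, with `a = ‖x‖ⁿ / √n!`, compares the series with an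
exponential series plus a geometric one. -/
theorem summable_norm_pow_div_sqrt_factorial (x : ℂ) :
    Summable fun n : ℕ => ‖x ^ n / (Real.sqrt (n.factorial : ℝ) : ℂ)‖ := by
  have h1 : Summable fun n : ℕ => (2 * ‖x‖ ^ 2) ^ n / (n.factorial : ℝ) :=
    Real.summable_pow_div_factorial _
  have h2 : Summable fun n : ℕ => ((1 : ℝ) / 2) ^ n :=
    summable_geometric_of_lt_one (by norm_num) (by norm_num)
  refine Summable.of_nonneg_of_le (fun n => norm_nonneg _) (fun n => ?_) (h1.add h2)
  have hf : (0 : ℝ) < n.factorial := by positivity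
  rw [norm_div, norm_pow, Complex.norm_real, Real.norm_of_nonneg (Real.sqrt_nonneg _)]
  set a := ‖x‖ ^ n / Real.sqrt n.factorial with ha
  have ha2 : (2 * ‖x‖ ^ 2) ^ n / (n.factorial : ℝ) = 2 ^ n * a ^ 2 := by
    rw [ha, div_pow, Real.sq_sqrt hf.le, mul_pow, ← pow_mul, ← pow_mul, mul_comm 2 n]; ring
  have h3 : ((1 : ℝ) / 2) ^ n * 2 ^ n = 1 := by rw [← mul_pow]; norm_num
  rw [ha2]
  have h4 : (0 : ℝ) < (1 / 2) ^ n := by positivity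
  have h5 : (0 : ℝ) < 2 ^ n := by positivity
  set u := ((1 : ℝ) / 2) ^ n
  set v := (2 : ℝ) ^ n
  have ha0 : 0 ≤ a := by positivity
  have hv : v * (v * a ^ 2 + u - a) = (v * a - 1/2) ^ 2 + 3 / 4 := by linear_combination h3
  have : 0 < v * a ^ 2 + u - a := by
    by_contra hc
    push Not at hc
    nlinarith [mul_nonpos_of_nonneg_of_nonpos h5.le hc, sq_nonneg (v * a - 1/2)]
  linarith

end PiSeries

/-! ### Entire functions given by power series -/

/-- The function `g` of `m` complex variables is the sum of the power series with coefficients `a`,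
which converges absolutely everywhere. -/
def HasEntireSeries {m : ℕ} (a : (Fin m → ℕ) → ℂ) (g : (Fin m → ℂ) → ℂ) : Prop :=
  ∀ z : Fin m → ℂ, (Summable fun k : Fin m → ℕ => ‖a k * ∏ i, z i ^ k i‖) ∧
    HasSum (fun k : Fin m → ℕ => a k * ∏ i, z i ^ k i) (g z)

/-- Collecting equal monomials of an absolutely convergent family. -/
theorem exists_hasEntireSeries_of_family {m : ℕ} {ι : Type*} (c : ι → ℂ) (e : ι → Fin m → ℕ)
    {g : (Fin m → ℂ) → ℂ} (hs : ∀ z : Fin m → ℂ, Summable fun x => ‖c x * ∏ i, z i ^ e x i‖)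
    (hg : ∀ z : Fin m → ℂ, HasSum (fun x => c x * ∏ i, z i ^ e x i) (g z)) :
    ∃ a, HasEntireSeries a g := by
  refine ⟨fun k => ∑' x : {x // e x = k}, c x, fun z => ?_⟩
  have key : ∀ k : Fin m → ℕ, (∑' x : {x // e x = k}, c x) * ∏ i, z i ^ k i =
      ∑' x : {x // e x = k}, c x * ∏ i, z i ^ e x i := by
    intro k
    rw [← tsum_mul_right]
    exact tsum_congr fun x => by rw [x.2]
  have h1 : Summable fun y : Σ k, {x // e x = k} => ‖c y.2 * ∏ i, z i ^ e y.2 i‖ :=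
    (Equiv.sigmaFiberEquiv e).summable_iff (f := fun x => ‖c x * ∏ i, z i ^ e x i‖) |>.2 (hs z)
  have h2 : HasSum (fun y : Σ k, {x // e x = k} => c y.2 * ∏ i, z i ^ e y.2 i) (g z) :=
    (Equiv.sigmaFiberEquiv e).hasSum_iff (f := fun x => c x * ∏ i, z i ^ e x i) |>.2 (hg z)
  simp_rw [key]
  refine ⟨?_, h2.sigma fun k => (h1.of_norm.sigma_factor k).hasSum⟩
  exact Summable.of_nonneg_of_le (fun k => norm_nonneg _)
    (fun k => norm_tsum_le_tsum_norm (h1.sigma_factor k)) h1.sigma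

theorem hasEntireSeries_mul {m : ℕ} {g₁ g₂ : (Fin m → ℂ) → ℂ} (h₁ : ∃ a, HasEntireSeries a g₁)
    (h₂ : ∃ a, HasEntireSeries a g₂) : ∃ a, HasEntireSeries a fun z => g₁ z * g₂ z := by
  obtain ⟨a, ha⟩ := h₁
  obtain ⟨b, hb⟩ := h₂
  have key : ∀ (z : Fin m → ℂ) (x : (Fin m → ℕ) × (Fin m → ℕ)),
      a x.1 * b x.2 * ∏ i, z i ^ (x.1 + x.2) i =
        (a x.1 * ∏ i, z i ^ x.1 i) * (b x.2 * ∏ i, z i ^ x.2 i) := by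
    intro z x
    simp only [Pi.add_apply, pow_add, Finset.prod_mul_distrib]
    ring
  refine exists_hasEntireSeries_of_family (fun x : (Fin m → ℕ) × (Fin m → ℕ) => a x.1 * b x.2)
    (fun x => x.1 + x.2) (fun z => ?_) fun z => ?_
  · simp_rw [key]
    exact Summable.mul_norm (f := fun k => a k * ∏ i, z i ^ k i)
      (g := fun k => b k * ∏ i, z i ^ k i) (ha z).1 (hb z).1
  · simp_rw [key]
    exact HasSum.mul (f := fun k => a k * ∏ i, z i ^ k i)
      (g := fun k => b k * ∏ i, z i ^ k i) (ha z).2 (hb z).2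
      (summable_mul_of_summable_norm (f := fun k => a k * ∏ i, z i ^ k i)
        (g := fun k => b k * ∏ i, z i ^ k i) (ha z).1 (hb z).1)

theorem hasEntireSeries_const {m : ℕ} (c : ℂ) :
    ∃ a, HasEntireSeries a fun _ : Fin m → ℂ => c := by
  refine exists_hasEntireSeries_of_family (fun _ : Unit => c) (fun _ => 0) (fun z => ?_) fun z => ?_
  · exact (hasSum_fintype _).summable
  · convert hasSum_fintype (fun _ : Unit => c * ∏ i, z i ^ (0 : Fin m → ℕ) i) using 1
    simp

theorem hasEntireSeries_linear {m : ℕ} (v : Fin m → ℂ) :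
    ∃ a, HasEntireSeries a fun z : Fin m → ℂ => ∑ j, v j * z j := by
  refine exists_hasEntireSeries_of_family v (fun j => Pi.single j 1) (fun z => ?_) fun z => ?_
  · exact (hasSum_fintype _).summable
  · convert hasSum_fintype (fun j => v j * ∏ i, z i ^ (Pi.single j 1 : Fin m → ℕ) i) using 1
    refine Finset.sum_congr rfl fun j _ => ?_
    rw [Finset.prod_eq_single j] <;> simp +contextual

theorem hasEntireSeries_prod {m : ℕ} {κ : Type*} (s : Finset κ) {g : κ → (Fin m → ℂ) → ℂ}
    (h : ∀ x ∈ s, ∃ a, HasEntireSeries a (g x)) :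
    ∃ a, HasEntireSeries a fun z => ∏ x ∈ s, g x z := by
  classical
  induction s using Finset.induction_on with
  | empty => simpa using hasEntireSeries_const (m := m) 1
  | insert x s hx ih =>
    simp_rw [Finset.prod_insert hx]
    exact hasEntireSeries_mul (h x (by simp)) (ih fun y hy => h y (by simp [hy]))

theorem hasEntireSeries_exp_monomial {m : ℕ} (c : ℂ) (k : Fin m → ℕ) :
    ∃ a, HasEntireSeries a fun z : Fin m → ℂ => Complex.exp (c * ∏ i, z i ^ k i) := by
  have key : ∀ (z : Fin m → ℂ) (n : ℕ), c ^ n / (n.factorial : ℂ) * ∏ i, z i ^ (n • k) i =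
      (c * ∏ i, z i ^ k i) ^ n / (n.factorial : ℂ) := by
    intro z n
    rw [mul_pow, ← Finset.prod_pow]
    simp_rw [Pi.smul_apply, smul_eq_mul, ← pow_mul, mul_comm n]
    ring
  refine exists_hasEntireSeries_of_family (fun n : ℕ => c ^ n / (n.factorial : ℂ))
    (fun n => n • k) (fun z => ?_) fun z => ?_
  · simp_rw [key]
    simpa using NormedSpace.norm_expSeries_div_summable (𝔸 := ℂ) (c * ∏ i, z i ^ k i)
  · simp_rw [key]
    rw [Complex.exp_eq_exp_ℂ]
    exact NormedSpace.expSeries_div_hasSum_exp _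

/-- The exponential of a polynomial is the product of the exponentials of its monomials, so closure
under products suffices; the coefficients themselves are never needed. -/
theorem hasEntireSeries_exp_quadratic {m : ℕ} (Λ : Matrix (Fin m) (Fin m) ℂ) (β : Fin m → ℂ) :
    ∃ a, HasEntireSeries a fun z : Fin m → ℂ =>
      Complex.exp (1 / 2 * (z ⬝ᵥ (Λ *ᵥ z)) + z ⬝ᵥ β) := by
  have h1 : ∀ z : Fin m → ℂ, Complex.exp (1 / 2 * (z ⬝ᵥ (Λ *ᵥ z)) + z ⬝ᵥ β) =
      (∏ i, ∏ j, Complex.exp (1 / 2 * Λ i j *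
        ∏ l, z l ^ (Pi.single i 1 + Pi.single j 1 : Fin m → ℕ) l)) *
      ∏ i, Complex.exp (β i * ∏ l, z l ^ (Pi.single i 1 : Fin m → ℕ) l) := by
    intro z
    have hs : ∀ i, ∏ l, z l ^ (Pi.single i 1 : Fin m → ℕ) l = z i := by
      intro i
      rw [Finset.prod_eq_single i] <;> simp +contextual
    simp_rw [Pi.add_apply, pow_add, Finset.prod_mul_distrib, hs, ← Complex.exp_sum]
    rw [← Complex.exp_add]
    congr 2
    · simp only [dotProduct, Matrix.mulVec, Finset.mul_sum]
      exact Finset.sum_congr rfl fun i _ => Finset.sum_congr rfl fun j _ => by ring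
    · simp only [dotProduct]
      exact Finset.sum_congr rfl fun i _ => by ring
  simp_rw [h1]
  exact hasEntireSeries_mul
    (hasEntireSeries_prod _ fun i _ => hasEntireSeries_prod _ fun j _ =>
      hasEntireSeries_exp_monomial _ _)
    (hasEntireSeries_prod _ fun i _ => hasEntireSeries_exp_monomial _ _)

/-! ### Gaussian integration over `ℂᵐ` -/

theorem integral_norm_pow_mul_exp_neg (k : ℕ) :
    ∫ z : ℂ, ‖z‖ ^ (2 * k) * Real.exp (-‖z‖ ^ 2) = Real.pi * k.factorial := by
  have h := Complex.integral_rpow_mul_exp_neg_rpow (p := 2) (q := ((2 * k : ℕ) : ℝ)) (by norm_num)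
    (by have : (0 : ℝ) ≤ ((2 * k : ℕ) : ℝ) := by positivity
        linarith)
  simp only [Real.rpow_natCast, Real.rpow_two] at h
  have h2 : (((2 * k : ℕ) : ℝ) + 2) / 2 = k + 1 := by push_cast; ring
  rw [h2, Real.Gamma_nat_eq_factorial, mul_div_cancel_left₀ _ (two_ne_zero)] at h
  exact h

theorem lintegral_monomial_mul_exp_neg_sqNorm {m : ℕ} (k : Fin m → ℕ) :
    ∫⁻ z : Fin m → ℂ, ENNReal.ofReal ((∏ i, ‖z i‖ ^ (2 * k i)) * Real.exp (-sqNorm z)) =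
      ENNReal.ofReal (Real.pi ^ m * ∏ i, ((k i).factorial : ℝ)) := by
  have h1 : ∀ z : Fin m → ℂ, (∏ i, ‖z i‖ ^ (2 * k i)) * Real.exp (-sqNorm z) =
      ∏ i, ‖z i‖ ^ (2 * k i) * Real.exp (-‖z i‖ ^ 2) := by
    intro z
    rw [Finset.prod_mul_distrib, ← Real.exp_sum, sqNorm, Finset.sum_neg_distrib]
  have h2 : ∫ z : Fin m → ℂ, (∏ i, ‖z i‖ ^ (2 * k i)) * Real.exp (-sqNorm z) =
      Real.pi ^ m * ∏ i, ((k i).factorial : ℝ) := by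
    simp_rw [h1]
    rw [integral_fintype_prod_volume_eq_prod
      (f := fun i (v : ℂ) => ‖v‖ ^ (2 * k i) * Real.exp (-‖v‖ ^ 2))]
    simp_rw [integral_norm_pow_mul_exp_neg, Finset.prod_mul_distrib]
    simp
  have h3 : 0 < Real.pi ^ m * ∏ i, ((k i).factorial : ℝ) := by
    have : ∀ i, (0 : ℝ) < (k i).factorial := fun i => by positivity
    have := Finset.prod_pos fun i (_ : i ∈ Finset.univ) => this i
    have := Real.pi_pos
    positivity
  rw [← h2]
  refine (ofReal_integral_eq_lintegral_ofReal ?_ (ae_of_all _ fun z => ?_)).symm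
  -- Integrability comes for free: a non-integrable function would have integral `0`, but the value
  -- is positive.
  · by_contra hc
    rw [integral_undef hc] at h2
    exact h3.ne h2
  · have := Finset.prod_nonneg fun i (_ : i ∈ Finset.univ) => pow_nonneg (norm_nonneg (z i)) (2 * k i)
    simp only [Pi.zero_apply]
    positivity

/-- Rotating one coordinate where `j` and `k` differ preserves the sup-norm ball and the measure.
The angle `θ = π / (k i₀ - j i₀)` is chosen so that the integrand changes sign. -/
theorem setIntegral_monomial_eq_zero {m : ℕ} {j k : Fin m → ℕ} (hjk : j ≠ k) (R : ℝ) :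
    ∫ z in Metric.closedBall (0 : Fin m → ℂ) R,
      (∏ i, conj (z i) ^ j i) * (∏ i, z i ^ k i) * (Real.exp (-sqNorm z) : ℂ) = 0 := by
  obtain ⟨i₀, hi₀⟩ := Function.ne_iff.1 hjk
  set θ : ℝ := Real.pi / ((k i₀ : ℝ) - j i₀)
  set u : Fin m → Circle := fun i => if i = i₀ then Circle.exp θ else 1 with hu
  let T : (Fin m → ℂ) ≃ᵐ (Fin m → ℂ) :=
    MeasurableEquiv.piCongrRight fun i => (rotation (u i)).toHomeomorph.toMeasurableEquiv
  have hTa : ∀ z i, T z i = u i * z i := fun z i => rfl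
  have hT : MeasurePreserving T volume volume :=
    volume_preserving_pi fun i => (rotation (u i)).measurePreserving
  have hn : ∀ z i, ‖T z i‖ = ‖z i‖ := fun z i => by rw [hTa, norm_mul, Circle.norm_coe, one_mul]
  set f : (Fin m → ℂ) → ℂ := fun z =>
    (∏ i, conj (z i) ^ j i) * (∏ i, z i ^ k i) * (Real.exp (-sqNorm z) : ℂ) with hf
  set g := (Metric.closedBall (0 : Fin m → ℂ) R).indicator f with hg
  have hphase : conj (Circle.exp θ : ℂ) ^ j i₀ * (Circle.exp θ : ℂ) ^ k i₀ = -1 := by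
    have hne : ((k i₀ : ℝ) - j i₀) ≠ 0 := by
      rw [sub_ne_zero]; exact_mod_cast hi₀.symm
    rw [Circle.coe_exp, ← Complex.exp_conj, ← Complex.exp_nat_mul, ← Complex.exp_nat_mul,
      ← Complex.exp_add, ← Complex.exp_pi_mul_I]
    congr 1
    simp only [map_mul, Complex.conj_ofReal, Complex.conj_I]
    have : (Real.pi : ℂ) = θ * ((k i₀ : ℂ) - j i₀) := by
      have : Real.pi = θ * ((k i₀ : ℝ) - j i₀) := (div_mul_cancel₀ _ hne).symm
      exact_mod_cast congrArg (fun x : ℝ => (x : ℂ)) this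
    rw [this]; ring
  have hprod : (∏ i, conj (u i : ℂ) ^ j i) * ∏ i, (u i : ℂ) ^ k i = -1 := by
    rw [← Finset.prod_mul_distrib, Finset.prod_eq_single i₀]
    · simpa [hu] using hphase
    · intro i _ hi; simp [hu, hi]
    · simp
  have hgT : ∀ z, g (T z) = -g z := by
    intro z
    have hmem : T z ∈ Metric.closedBall (0 : Fin m → ℂ) R ↔ z ∈ Metric.closedBall (0 : Fin m → ℂ) R := by
      simp only [mem_closedBall_zero_iff]
      have : ‖T z‖ = ‖z‖ := by simp only [Pi.norm_def]; congr 2; funext i; exact NNReal.eq (hn z i)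
      rw [this]
    have hfT : f (T z) = -f z := by
      simp only [hf, sqNorm, hn]
      simp only [hTa, map_mul, mul_pow, Finset.prod_mul_distrib]
      linear_combination (∏ i, conj (z i) ^ j i) * (∏ i, z i ^ k i) *
        (Real.exp (-∑ i, ‖z i‖ ^ 2) : ℂ) * hprod
    by_cases hz : z ∈ Metric.closedBall (0 : Fin m → ℂ) R
    · rw [hg, Set.indicator_of_mem (hmem.2 hz), Set.indicator_of_mem hz, hfT]
    · rw [hg, Set.indicator_of_notMem (fun h => hz (hmem.1 h)), Set.indicator_of_notMem hz, neg_zero]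
  have h1 : ∫ z, g (T z) = ∫ z, g z := hT.integral_comp' g
  simp_rw [hgT, integral_neg] at h1
  rw [← integral_indicator Metric.isClosed_closedBall.measurableSet]
  change ∫ z, g z = 0
  linear_combination (-1 / 2) * h1

theorem norm_prod_pow_le {m : ℕ} {z : Fin m → ℂ} {R : ℝ} (hz : ‖z‖ ≤ R) (k : Fin m → ℕ) :
    ‖∏ i, z i ^ k i‖ ≤ ‖∏ i : Fin m, (R : ℂ) ^ k i‖ := by
  rw [norm_prod, norm_prod]
  refine Finset.prod_le_prod (fun i _ => norm_nonneg _) fun i _ => ?_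
  rw [norm_pow, norm_pow, Complex.norm_real]
  exact pow_le_pow_left₀ (norm_nonneg _)
    ((norm_le_pi_norm z i).trans (hz.trans (le_abs_self R))) _

/-- Gaussian integration of a nonnegative function given by a sesquilinear power series only sees
the diagonal coefficients. -/
theorem lintegral_sesquilinear_series {m : ℕ} {C : (Fin m → ℕ) → (Fin m → ℕ) → ℂ}
    {d : (Fin m → ℕ) → ℝ} (hd : ∀ k, 0 ≤ d k) (hC : ∀ k, C k k = d k) {h : (Fin m → ℂ) → ℝ}
    (h0 : ∀ z, 0 ≤ h z) (hc : Continuous h)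
    (hs : ∀ z : Fin m → ℂ, Summable fun x : (Fin m → ℕ) × (Fin m → ℕ) =>
      ‖C x.1 x.2 * ((∏ i, conj (z i) ^ x.1 i) * ∏ i, z i ^ x.2 i)‖)
    (hh : ∀ z : Fin m → ℂ, HasSum (fun x : (Fin m → ℕ) × (Fin m → ℕ) =>
      C x.1 x.2 * ((∏ i, conj (z i) ^ x.1 i) * ∏ i, z i ^ x.2 i)) (h z : ℂ)) :
    ∫⁻ z : Fin m → ℂ, ENNReal.ofReal (h z * Real.exp (-sqNorm z)) =
      ∑' k, ENNReal.ofReal (d k * (Real.pi ^ m * ∏ i, ((k i).factorial : ℝ))) := by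
  set G : (Fin m → ℕ) → (Fin m → ℂ) → ℝ := fun k z =>
    d k * ((∏ i, ‖z i‖ ^ (2 * k i)) * Real.exp (-sqNorm z)) with hG
  have hGc : ∀ k, Continuous (G k) := fun k => by
    simp only [hG, sqNorm]; fun_prop
  have hG0 : ∀ k z, 0 ≤ G k z := fun k z => by
    have := Finset.prod_nonneg fun i (_ : i ∈ Finset.univ) =>
      pow_nonneg (norm_nonneg (z i)) (2 * k i)
    have := hd k
    positivity
  have hE1 : ∀ z : Fin m → ℂ, Real.exp (-sqNorm z) ≤ 1 := fun z => by
    rw [Real.exp_le_one_iff, neg_nonpos]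
    exact Finset.sum_nonneg fun i _ => by positivity
  set F : (Fin m → ℕ) × (Fin m → ℕ) → (Fin m → ℂ) → ℂ := fun x z =>
    C x.1 x.2 * ((∏ i, conj (z i) ^ x.1 i) * (∏ i, z i ^ x.2 i)) * (Real.exp (-sqNorm z) : ℂ) with hF
  have hFc : ∀ x, Continuous (F x) := fun x => by
    simp only [hF, sqNorm]; fun_prop
  have hFs : ∀ z, HasSum (fun x => F x z) ((h z * Real.exp (-sqNorm z) : ℝ) : ℂ) := fun z => by
    rw [Complex.ofReal_mul]; exact (hh z).mul_right _
  -- The double series can be integrated termwise on bounded sets, where it converges uniformly.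
  -- Once only nonnegative diagonal terms remain, the balls exhaust the space by monotone
  -- convergence.
  have hball : ∀ N : ℕ, ∫⁻ z in Metric.closedBall (0 : Fin m → ℂ) N,
      ENNReal.ofReal (h z * Real.exp (-sqNorm z)) =
      ∫⁻ z in Metric.closedBall (0 : Fin m → ℂ) N, ∑' k, ENNReal.ofReal (G k z) := by
    intro N
    set D := Metric.closedBall (0 : Fin m → ℂ) N with hD
    have hDm : MeasurableSet D := Metric.isClosed_closedBall.measurableSet
    have hDc : IsCompact D := isCompact_closedBall _ _
    have : IsFiniteMeasure (volume.restrict D) := ⟨by simpa using hDc.measure_lt_top⟩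
    have hFi : ∀ x, Integrable (F x) (volume.restrict D) := fun x =>
      (hFc x).continuousOn.integrableOn_compact hDc
    have hGi : ∀ x, Integrable (G x) (volume.restrict D) := fun x =>
      (hGc x).continuousOn.integrableOn_compact hDc
    have hFb : ∀ x, ∀ z ∈ D, ‖F x z‖ ≤
        ‖C x.1 x.2 * ((∏ i : Fin m, conj ((N : ℝ) : ℂ) ^ x.1 i) *
          ∏ i : Fin m, ((N : ℝ) : ℂ) ^ x.2 i)‖ := by
      intro x z hz
      rw [hD, mem_closedBall_zero_iff] at hz
      have h1 := norm_prod_pow_le hz x.1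
      have h2 := norm_prod_pow_le hz x.2
      have h3 : ‖∏ i, conj (z i) ^ x.1 i‖ = ‖∏ i, z i ^ x.1 i‖ := by
        simp [norm_prod]
      simp only [hF, Complex.conj_ofReal]
      rw [norm_mul, norm_mul, norm_mul, norm_mul, norm_mul, h3, Complex.norm_real,
        Real.norm_of_nonneg (Real.exp_pos _).le]
      calc _ ≤ ‖C x.1 x.2‖ * (‖∏ i, z i ^ x.1 i‖ * ‖∏ i, z i ^ x.2 i‖) * 1 := by
            gcongr; exact hE1 z
        _ ≤ _ := by rw [mul_one]; gcongr
    -- The dominating series is the hypothesis `hs` at the constant vector `(N, …, N)`, times the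
    -- volume of the ball.
    have hFsum : Summable fun x => ∫ z in D, ‖F x z‖ := by
      refine Summable.of_nonneg_of_le (fun x => integral_nonneg fun z => norm_nonneg _)
        (fun x => ?_) ((hs fun _ => ((N : ℝ) : ℂ)).mul_right (volume.real D))
      have := setIntegral_mono_on (hFi x).norm (integrable_const _) hDm (hFb x)
      rwa [setIntegral_const, smul_eq_mul, mul_comm] at this
    have hI := hasSum_integral_of_summable_integral_norm hFi hFsum
    have hIeq : ∫ z in D, ∑' x, F x z =
        ((∫ z in D, h z * Real.exp (-sqNorm z) : ℝ) : ℂ) := by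
      rw [← integral_complex_ofReal]
      exact integral_congr_ae (ae_of_all _ fun z => (hFs z).tsum_eq)
    rw [hIeq] at hI
    have hinj : Function.Injective fun k : Fin m → ℕ => (k, k) := fun a b hab => (Prod.mk.inj hab).1
    have hoff : ∀ x ∉ Set.range fun k : Fin m → ℕ => (k, k), ∫ z in D, F x z = 0 := by
      intro x hx
      have hne : x.1 ≠ x.2 := fun hc => hx ⟨x.1, Prod.ext rfl hc⟩
      simp only [hF, mul_assoc]
      rw [integral_const_mul]
      simp only [← mul_assoc]
      rw [setIntegral_monomial_eq_zero hne, mul_zero]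
    rw [← hinj.hasSum_iff hoff] at hI
    have hdiag : ∀ k, ∫ z in D, F (k, k) z = ((∫ z in D, G k z : ℝ) : ℂ) := by
      intro k
      rw [← integral_complex_ofReal]
      refine integral_congr_ae (ae_of_all _ fun z => ?_)
      simp only [hF, hG, hC, Complex.ofReal_mul, Complex.ofReal_prod, Complex.ofReal_pow]
      rw [← Finset.prod_mul_distrib, mul_assoc]
      congr 3
      funext i
      rw [← mul_pow, mul_comm 2, pow_mul', ← Complex.normSq_eq_conj_mul_self, Complex.normSq_eq_norm_sq]
      push_cast; rfl
    have hI' : HasSum (fun k => ∫ z in D, G k z) (∫ z in D, h z * Real.exp (-sqNorm z)) := by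
      rw [← Complex.hasSum_ofReal]
      convert hI using 1
      funext k
      exact (hdiag k).symm
    have hhi : Integrable (fun z => h z * Real.exp (-sqNorm z)) (volume.restrict D) := by
      have hcont : Continuous fun z : Fin m → ℂ => h z * Real.exp (-sqNorm z) := by
        simp only [sqNorm]; fun_prop
      exact hcont.continuousOn.integrableOn_compact hDc
    rw [← ofReal_integral_eq_lintegral_ofReal hhi
      (ae_of_all _ fun z => mul_nonneg (h0 z) (Real.exp_pos _).le), ← hI'.tsum_eq,
      ENNReal.ofReal_tsum_of_nonneg (fun k => integral_nonneg (hG0 k)) hI'.summable,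
      lintegral_tsum fun k => (hGc k).measurable.ennreal_ofReal.aemeasurable]
    exact tsum_congr fun k => ofReal_integral_eq_lintegral_ofReal (hGi k) (ae_of_all _ (hG0 k))
  have hdir : Directed (· ⊆ ·) fun N : ℕ => Metric.closedBall (0 : Fin m → ℂ) N :=
    directed_of_isDirected_le fun a b hab =>
      Metric.closedBall_subset_closedBall (by exact_mod_cast hab)
  have huniv : ⋃ N : ℕ, Metric.closedBall (0 : Fin m → ℂ) N = Set.univ :=
    Metric.iUnion_closedBall_nat _
  rw [← setLIntegral_univ, ← huniv, setLIntegral_iUnion_of_directed _ hdir]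
  simp_rw [hball]
  rw [← setLIntegral_iUnion_of_directed _ hdir, huniv, setLIntegral_univ,
    lintegral_tsum fun k => (hGc k).measurable.ennreal_ofReal.aemeasurable]
  refine tsum_congr fun k => ?_
  rw [ENNReal.ofReal_mul (hd k), ← lintegral_monomial_mul_exp_neg_sqNorm,
    ← lintegral_const_mul' _ _ ENNReal.ofReal_ne_top]
  refine lintegral_congr fun z => ?_
  rw [← ENNReal.ofReal_mul (hd k)]

/-! ### Coherent states and the power series of the Bargmann function -/

/-- `∏ i, √(k i)!`. -/
def sqrtFactorial {m : ℕ} (k : Fin m → ℕ) : ℝ := ∏ i, Real.sqrt ((k i).factorial : ℝ)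

theorem sqrtFactorial_pos {m : ℕ} (k : Fin m → ℕ) : 0 < sqrtFactorial k :=
  Finset.prod_pos fun i _ => Real.sqrt_pos.2 (by positivity)

theorem sqrtFactorial_sq {m : ℕ} (k : Fin m → ℕ) :
    sqrtFactorial k ^ 2 = ∏ i, ((k i).factorial : ℝ) := by
  rw [sqrtFactorial, ← Finset.prod_pow]
  exact Finset.prod_congr rfl fun i _ => Real.sq_sqrt (by positivity)

theorem coherentCoeff_eq {m : ℕ} (α : Fin m → ℂ) (k : Fin m → ℕ) :
    coherentCoeff α k =
      (Real.exp (-(sqNorm α) / 2) : ℂ) * ((∏ i, α i ^ k i) / (sqrtFactorial k : ℂ)) := by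
  rw [coherentCoeff, Finset.prod_div_distrib, sqrtFactorial, Complex.ofReal_prod]

theorem sqNorm_star {m : ℕ} (z : Fin m → ℂ) : sqNorm (star z) = sqNorm z := by
  simp [sqNorm]

theorem conj_coherentCoeff_star {m : ℕ} (α : Fin m → ℂ) (k : Fin m → ℕ) :
    conj (coherentCoeff (star α) k) = coherentCoeff α k := by
  rw [coherentCoeff_eq, coherentCoeff_eq, sqNorm_star]
  simp only [map_mul, map_div₀, map_prod, map_pow, Complex.conj_ofReal, Pi.star_apply,
    Complex.star_def, Complex.conj_conj]

/-- Being `ℓ¹`, and not just `ℓ²`, lets the bare bound `‖ρ‖` on matrix elements make the double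
series for `⟨z̄|ρ|w⟩` absolutely convergent. -/
theorem summable_norm_coherentCoeff {m : ℕ} (α : Fin m → ℂ) :
    Summable fun k => ‖coherentCoeff α k‖ := by
  simp only [coherentCoeff, norm_mul]
  exact (summable_norm_prod_pi (f := fun i n => α i ^ n / (Real.sqrt (n.factorial : ℝ) : ℂ))
    fun i => summable_norm_pow_div_sqrt_factorial (α i)).mul_left _

theorem inner_coherentState_star {m : ℕ} (z : Fin m → ℂ) (φ : Fock m) :
    HasSum (fun k => coherentCoeff z k * φ k) (inner ℂ (coherentState (star z)) φ) := by
  refine (lp.hasSum_inner (𝕜 := ℂ) (coherentState (star z)) φ).congr_fun ?_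
  intro k
  rw [← conj_coherentCoeff_star]
  exact (mul_comm _ _).symm

theorem norm_numberState {m : ℕ} (k : Fin m → ℕ) : ‖(numberState k : Fock m)‖ = 1 := by
  rw [numberState, lp.norm_single (by norm_num), norm_one]

theorem hasSum_coherentState {m : ℕ} (α : Fin m → ℂ) :
    HasSum (fun k => coherentCoeff α k • (numberState k : Fock m)) (coherentState α) := by
  have h := lp.hasSum_single (p := 2) (by norm_num) (coherentState α)
  refine h.congr_fun fun k => ?_
  rw [numberState, ← lp.single_smul, smul_eq_mul, mul_one]
  rfl

/-- The matrix elements of `ρ` in the number basis. -/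
def matrixElement {m : ℕ} (ρ : Fock m →L[ℂ] Fock m) (j k : Fin m → ℕ) : ℂ :=
  inner ℂ (numberState j) (ρ (numberState k))

theorem norm_matrixElement_le {m : ℕ} (ρ : Fock m →L[ℂ] Fock m) (j k : Fin m → ℕ) :
    ‖matrixElement ρ j k‖ ≤ ‖ρ‖ := by
  refine (norm_inner_le_norm _ _).trans ?_
  rw [norm_numberState, one_mul]
  simpa [norm_numberState] using ρ.le_opNorm (numberState k : Fock m)

theorem summable_matrixElement {m : ℕ} (ρ : Fock m →L[ℂ] Fock m) (z w : Fin m → ℂ) :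
    Summable fun x : (Fin m → ℕ) × (Fin m → ℕ) =>
      ‖matrixElement ρ x.1 x.2 * (coherentCoeff z x.1 * coherentCoeff w x.2)‖ := by
  refine Summable.of_nonneg_of_le (fun x => norm_nonneg _) (fun x => ?_)
    (((summable_norm_coherentCoeff z).mul_norm (summable_norm_coherentCoeff w)).mul_left ‖ρ‖)
  rw [norm_mul]
  exact mul_le_mul_of_nonneg_right (norm_matrixElement_le ρ _ _) (norm_nonneg _)

/-- Expanding the ket and then the bra gives an iterated sum; absolute summability identifies it
with the double sum. -/
theorem hasSum_inner_coherentState {m : ℕ} (ρ : Fock m →L[ℂ] Fock m) (z w : Fin m → ℂ) :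
    HasSum (fun x : (Fin m → ℕ) × (Fin m → ℕ) =>
      matrixElement ρ x.1 x.2 * (coherentCoeff z x.1 * coherentCoeff w x.2))
      (inner ℂ (coherentState (star z)) (ρ (coherentState w))) := by
  have h1 := (summable_matrixElement ρ z w).of_norm.hasSum
  have h2 : HasSum (fun k => inner ℂ (coherentState (star z))
      (ρ (coherentCoeff w k • (numberState k : Fock m))))
      (inner ℂ (coherentState (star z)) (ρ (coherentState w))) :=
    ((innerSL ℂ (coherentState (star z))).comp ρ).hasSum (hasSum_coherentState w)
  have h3 : ∀ k, HasSum (fun j =>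
      matrixElement ρ j k * (coherentCoeff z j * coherentCoeff w k))
      (inner ℂ (coherentState (star z)) (ρ (coherentCoeff w k • (numberState k : Fock m)))) := by
    intro k
    rw [map_smul, inner_smul_right]
    refine ((inner_coherentState_star z (ρ (numberState k))).mul_left (coherentCoeff w k)).congr_fun
      fun j => ?_
    rw [matrixElement, numberState, lp.inner_single_left]
    simp only [RCLike.inner_apply, map_one, mul_one]
    ring
  have h4 := ((Equiv.prodComm _ _).hasSum_iff.2 h1).prod_fiberwise h3
  rwa [h4.unique h2] at h1

theorem exp_mul_exp_neg_half (r s : ℝ) :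
    (Real.exp ((r + s) / 2) : ℂ) * ((Real.exp (-s / 2) : ℂ) * (Real.exp (-r / 2) : ℂ)) = 1 := by
  rw [← Complex.ofReal_mul, ← Complex.ofReal_mul, ← Real.exp_add, ← Real.exp_add]
  rw [show (r + s) / 2 + (-s / 2 + -r / 2) = 0 by ring, Real.exp_zero, Complex.ofReal_one]

theorem bargmann_term {m : ℕ} (ρ : Fock m →L[ℂ] Fock m) (w z : Fin m → ℂ)
    (x : (Fin m → ℕ) × (Fin m → ℕ)) :
    (Real.exp ((sqNorm w + sqNorm z) / 2) : ℂ) *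
        (matrixElement ρ x.1 x.2 * (coherentCoeff z x.1 * coherentCoeff w x.2)) =
      matrixElement ρ x.1 x.2 / ((sqrtFactorial x.1 : ℂ) * sqrtFactorial x.2) *
        ((∏ i, z i ^ x.1 i) * ∏ i, w i ^ x.2 i) := by
  rw [coherentCoeff_eq, coherentCoeff_eq]
  have h1 := exp_mul_exp_neg_half (sqNorm w) (sqNorm z)
  generalize (Real.exp ((sqNorm w + sqNorm z) / 2) : ℂ) = e₀ at h1 ⊢
  generalize (Real.exp (-sqNorm z / 2) : ℂ) = e₁ at h1 ⊢
  generalize (Real.exp (-sqNorm w / 2) : ℂ) = e₂ at h1 ⊢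
  have h2 : (sqrtFactorial x.1 : ℂ) ≠ 0 := by exact_mod_cast (sqrtFactorial_pos x.1).ne'
  have h3 : (sqrtFactorial x.2 : ℂ) ≠ 0 := by exact_mod_cast (sqrtFactorial_pos x.2).ne'
  field_simp
  linear_combination (matrixElement ρ x.1 x.2 * (∏ i, z i ^ x.1 i) * ∏ i, w i ^ x.2 i) * h1

/-- The Bargmann function as a power series with coefficients the matrix elements. -/
theorem hasSum_bargmann {m : ℕ} (ρ : Fock m →L[ℂ] Fock m) (w z : Fin m → ℂ) :
    HasSum (fun x : (Fin m → ℕ) × (Fin m → ℕ) =>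
      matrixElement ρ x.1 x.2 / ((sqrtFactorial x.1 : ℂ) * sqrtFactorial x.2) *
        ((∏ i, z i ^ x.1 i) * ∏ i, w i ^ x.2 i)) (bargmann ρ (Sum.elim w z)) := by
  simp_rw [← bargmann_term]
  exact (hasSum_inner_coherentState ρ z w).mul_left _

theorem summable_bargmann {m : ℕ} (ρ : Fock m →L[ℂ] Fock m) (w z : Fin m → ℂ) :
    Summable fun x : (Fin m → ℕ) × (Fin m → ℕ) =>
      ‖matrixElement ρ x.1 x.2 / ((sqrtFactorial x.1 : ℂ) * sqrtFactorial x.2) *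
        ((∏ i, z i ^ x.1 i) * ∏ i, w i ^ x.2 i)‖ := by
  simp_rw [← bargmann_term, norm_mul (Real.exp _ : ℂ)]
  exact (summable_matrixElement ρ z w).mul_left _

theorem bargmann_star_nonneg {m : ℕ} {ρ : Fock m →L[ℂ] Fock m} (hρ : ρ.IsPositive)
    (z : Fin m → ℂ) : 0 ≤ bargmann ρ (Sum.elim z (star z)) := by
  rw [bargmann, Sum.elim_comp_inl, Sum.elim_comp_inr, star_star]
  refine mul_nonneg ?_ (hρ.inner_nonneg_right _)
  exact_mod_cast (Real.exp_pos _).le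

/-- The trace of a density operator as the integral of its Husimi function. -/
theorem IsDensityOperator.lintegral_bargmann {m : ℕ} {ρ : Fock m →L[ℂ] Fock m}
    (hρ : IsDensityOperator ρ)
    (hc : Continuous fun z : Fin m → ℂ => bargmann ρ (Sum.elim z (star z))) :
    ∫⁻ z : Fin m → ℂ, ENNReal.ofReal
      ((bargmann ρ (Sum.elim z (star z))).re * Real.exp (-sqNorm z)) =
      ENNReal.ofReal (Real.pi ^ m) := by
  have hdiag : ∀ k, 0 ≤ matrixElement ρ k k := fun k => hρ.isPositive.inner_nonneg_right _
  have hre : ∀ k, ((matrixElement ρ k k).re : ℂ) = matrixElement ρ k k := fun k =>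
    (Complex.eq_re_of_ofReal_le (r := 0) (by simpa using hdiag k)).symm
  have hre0 : ∀ k, 0 ≤ (matrixElement ρ k k).re := fun k => (Complex.nonneg_iff.1 (hdiag k)).1
  have hbre : ∀ z : Fin m → ℂ, ((bargmann ρ (Sum.elim z (star z))).re : ℂ) =
      bargmann ρ (Sum.elim z (star z)) := fun z =>
    (Complex.eq_re_of_ofReal_le (r := 0) (by simpa using bargmann_star_nonneg hρ.isPositive z)).symm
  -- The diagonal coefficient `ρₖₖ / k!` meets the moment `πᵐ k!`, so each term contributes `πᵐ
  -- ρₖₖ`.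
  rw [lintegral_sesquilinear_series
    (C := fun j k => matrixElement ρ j k / ((sqrtFactorial j : ℂ) * sqrtFactorial k))
    (d := fun k => (matrixElement ρ k k).re / ∏ i, ((k i).factorial : ℝ))
    (fun k => div_nonneg (hre0 k) (Finset.prod_nonneg fun i _ => by positivity))
    (fun k => ?_) (fun z => (Complex.nonneg_iff.1 (bargmann_star_nonneg hρ.isPositive z)).1)
    (Complex.continuous_re.comp hc) (fun z => summable_bargmann ρ z (star z)) fun z => ?_]
  · have h1 : ∀ k : Fin m → ℕ, (matrixElement ρ k k).re / (∏ i, ((k i).factorial : ℝ)) *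
        (Real.pi ^ m * ∏ i, ((k i).factorial : ℝ)) = (matrixElement ρ k k).re * Real.pi ^ m := by
      intro k
      have : (∏ i, ((k i).factorial : ℝ)) ≠ 0 := by
        rw [← sqrtFactorial_sq]; exact pow_ne_zero _ (sqrtFactorial_pos k).ne'
      field_simp
    simp_rw [h1]
    have h2 : HasSum (fun k => (matrixElement ρ k k).re) 1 := by
      simpa [matrixElement] using Complex.reCLM.hasSum hρ.hasSum_trace
    have h3 := h2.mul_right (Real.pi ^ m)
    rw [← ENNReal.ofReal_tsum_of_nonneg (fun k => mul_nonneg (hre0 k) (by positivity)) h3.summable,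
      h3.tsum_eq, one_mul]
  · rw [Complex.ofReal_div, hre, ← sqrtFactorial_sq, Complex.ofReal_pow, sq]
  · rw [hbre]
    exact hasSum_bargmann ρ z (star z)

/-! ### Vectors from entire functions, and mixtures of pure states -/

/-- An entire function which is square integrable for the Gaussian measure is the Bargmann function
of a vector. -/
theorem exists_fock_of_hasEntireSeries {m : ℕ} {a : (Fin m → ℕ) → ℂ} {g : (Fin m → ℂ) → ℂ}
    (ha : HasEntireSeries a g) (hg : Continuous g)
    (hfin : ∫⁻ z : Fin m → ℂ, ENNReal.ofReal (‖g z‖ ^ 2 * Real.exp (-sqNorm z)) ≠ ⊤) :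
    ∃ φ : Fock m, (∀ z, inner ℂ (coherentState (star z)) φ =
        (Real.exp (-(sqNorm z) / 2) : ℂ) * g z) ∧
      ENNReal.ofReal (‖φ‖ ^ 2 * Real.pi ^ m) =
        ∫⁻ z : Fin m → ℂ, ENNReal.ofReal (‖g z‖ ^ 2 * Real.exp (-sqNorm z)) := by
  have hterm : ∀ (z : Fin m → ℂ) (x : (Fin m → ℕ) × (Fin m → ℕ)),
      conj (a x.1) * a x.2 * ((∏ i, conj (z i) ^ x.1 i) * ∏ i, z i ^ x.2 i) =
      conj (a x.1 * ∏ i, z i ^ x.1 i) * (a x.2 * ∏ i, z i ^ x.2 i) := by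
    intro z x
    simp only [map_mul, map_prod, map_pow]
    ring
  have hcs : ∀ z : Fin m → ℂ, Summable fun k => ‖conj (a k * ∏ i, z i ^ k i)‖ := fun z => by
    simpa only [RCLike.norm_conj] using (ha z).1
  have hP := lintegral_sesquilinear_series (C := fun j k => conj (a j) * a k)
    (d := fun k => ‖a k‖ ^ 2) (fun k => by positivity)
    (fun k => by rw [← Complex.normSq_eq_conj_mul_self, Complex.normSq_eq_norm_sq])
    (h := fun z => ‖g z‖ ^ 2) (fun z => by positivity) (by fun_prop)
    (fun z => by
      simp_rw [hterm]
      exact Summable.mul_norm (f := fun k => conj (a k * ∏ i, z i ^ k i))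
        (g := fun k => a k * ∏ i, z i ^ k i) (hcs z) (ha z).1)
    (fun z => by
      simp_rw [hterm]
      rw [← Complex.normSq_eq_norm_sq, Complex.normSq_eq_conj_mul_self]
      exact HasSum.mul (f := fun k => conj (a k * ∏ i, z i ^ k i))
        (g := fun k => a k * ∏ i, z i ^ k i) (Complex.hasSum_conj'.2 (ha z).2) (ha z).2
        (summable_mul_of_summable_norm (f := fun k => conj (a k * ∏ i, z i ^ k i))
          (g := fun k => a k * ∏ i, z i ^ k i) (hcs z) (ha z).1))
  have hterm2 : ∀ k, ‖a k‖ ^ 2 * (Real.pi ^ m * ∏ i, ((k i).factorial : ℝ)) =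
      ‖a k * (sqrtFactorial k : ℂ)‖ ^ 2 * Real.pi ^ m := by
    intro k
    rw [← sqrtFactorial_sq, norm_mul, Complex.norm_real, Real.norm_of_nonneg (sqrtFactorial_pos k).le]
    ring
  simp_rw [hterm2] at hP
  have hsum : Summable fun k => ‖a k * (sqrtFactorial k : ℂ)‖ ^ 2 := by
    rw [hP] at hfin
    have := ENNReal.summable_toReal hfin
    have h0 : ∀ k, (ENNReal.ofReal (‖a k * (sqrtFactorial k : ℂ)‖ ^ 2 * Real.pi ^ m)).toReal =
        ‖a k * (sqrtFactorial k : ℂ)‖ ^ 2 * Real.pi ^ m := fun k =>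
      ENNReal.toReal_ofReal (by positivity)
    simp_rw [h0] at this
    exact (summable_mul_right_iff (by positivity)).1 this
  -- The factor `√k!` cancels the denominator of the coherent amplitudes, so this vector has `g` as
  -- its Bargmann function.
  have hmem : Memℓp (fun k => a k * (sqrtFactorial k : ℂ)) 2 := by
    refine memℓp_gen ?_
    simpa using hsum
  refine ⟨⟨_, hmem⟩, fun z => ?_, ?_⟩
  · refine (inner_coherentState_star z _).unique ?_
    refine ((ha z).2.mul_left (Real.exp (-(sqNorm z) / 2) : ℂ)).congr_fun fun k => ?_
    have h2 : (sqrtFactorial k : ℂ) ≠ 0 := by exact_mod_cast (sqrtFactorial_pos k).ne'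
    rw [coherentCoeff_eq]
    change _ * (a k * (sqrtFactorial k : ℂ)) = _
    field_simp
  · have h1 : HasSum (fun k => ‖a k * (sqrtFactorial k : ℂ)‖ ^ 2)
        (‖(⟨_, hmem⟩ : Fock m)‖ ^ 2) := by
      have := lp.hasSum_norm (p := 2) (by norm_num) (⟨_, hmem⟩ : Fock m)
      simpa using this
    have h2 := h1.mul_right (Real.pi ^ m)
    rw [hP, ← h2.tsum_eq, ENNReal.ofReal_tsum_of_nonneg (fun k => by positivity) h2.summable]

/-- Mixtures of pure states. -/
theorem exists_isDensityOperator_of_hasSum {m : ℕ} {ι : Type*} (φ : ι → Fock m)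
    (hφ : HasSum (fun l => ‖φ l‖ ^ 2) 1) :
    ∃ ρ : Fock m →L[ℂ] Fock m, IsDensityOperator ρ ∧
      ∀ x y, HasSum (fun l => inner ℂ x (φ l) * inner ℂ (φ l) y) (inner ℂ x (ρ y)) := by
  set P : ι → (Fock m →L[ℂ] Fock m) := fun l => InnerProductSpace.rankOne ℂ (φ l) (φ l) with hP
  -- Since `‖|φ⟩⟨φ|‖ = ‖φ‖²`, the mixture converges absolutely in operator norm.
  have hsum : Summable P := by
    refine Summable.of_norm ?_
    simp only [hP, InnerProductSpace.norm_rankOne, ← sq]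
    exact hφ.summable
  have hin : ∀ x y, HasSum (fun l => inner ℂ x (φ l) * inner ℂ (φ l) y)
      (inner ℂ x ((∑' l, P l) y)) := by
    intro x y
    have h1 := ((innerSL ℂ x).comp (ContinuousLinearMap.apply ℂ (Fock m) y)).hasSum hsum.hasSum
    refine h1.congr_fun fun l => ?_
    simp [hP, mul_comm]
  refine ⟨∑' l, P l, ⟨?_, ?_⟩, hin⟩
  · rw [ContinuousLinearMap.isPositive_iff_complex]
    intro x
    have h1 : HasSum (fun l => ((‖inner ℂ x (φ l)‖ ^ 2 : ℝ) : ℂ))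
        (inner ℂ x ((∑' l, P l) x)) := by
      refine (hin x x).congr_fun fun l => ?_
      rw [← inner_conj_symm (φ l) x, Complex.mul_conj, Complex.normSq_eq_norm_sq]
    have h2 : HasSum (fun l => ‖inner ℂ x (φ l)‖ ^ 2) (inner ℂ x ((∑' l, P l) x)).re := by
      exact (Complex.reCLM.hasSum h1).congr_fun fun l => rfl
    have h3 : ((inner ℂ x ((∑' l, P l) x)).re : ℂ) = inner ℂ x ((∑' l, P l) x) :=
      (Complex.hasSum_ofReal.2 h2).unique h1
    have h4 := h2.nonneg fun l => by positivity
    rw [← inner_conj_symm, ← h3]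
    simpa using h4
  · have h1 : ∀ l, HasSum (fun k => ‖φ l k‖ ^ 2) (‖φ l‖ ^ 2) := fun l => by
      simpa using lp.hasSum_norm (p := 2) (by norm_num) (φ l)
    -- Nonnegative terms: summing over `k` first gives `∑ ‖φ l‖² = 1`, summing over `l` first gives
    -- the trace.
    have h2 : Summable fun x : ι × (Fin m → ℕ) => ‖φ x.1 x.2‖ ^ 2 := by
      rw [summable_prod_of_nonneg fun x => by positivity]
      exact ⟨fun l => (h1 l).summable, by simpa only [(h1 _).tsum_eq] using hφ.summable⟩
    have h3 := h2.hasSum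
    rw [(h3.prod_fiberwise h1).unique hφ] at h3
    have h4 : ∀ k, HasSum (fun l => ((‖φ l k‖ ^ 2 : ℝ) : ℂ))
        (inner ℂ (numberState k) ((∑' l, P l) (numberState k))) := by
      intro k
      refine (hin _ _).congr_fun fun l => ?_
      rw [← inner_conj_symm (φ l), Complex.mul_conj, Complex.normSq_eq_norm_sq, numberState,
        lp.inner_single_left]
      simp
    have h5 := (Equiv.prodComm _ _).hasSum_iff.2 (Complex.hasSum_ofReal.2 h3)
    have h6 := h5.prod_fiberwise h4
    simpa using h6

/-! ### Real Gaussian integrals -/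

section RealGaussian

variable {ι : Type*} [Fintype ι]

/-- An integrable function that is midpoint convex along a nonzero vector vanishes. -/
theorem lintegral_eq_zero_of_midpoint_convex {f : (ι → ℝ) → ENNReal}
    (hf : Measurable f) (hfin : ∫⁻ x, f x ≠ ⊤) {v : ι → ℝ} (hv : v ≠ 0)
    (hconv : ∀ (x : ι → ℝ) (n : ℕ), 2 * f x ≤ f (x + (n : ℝ) • v) + f (x - (n : ℝ) • v)) :
    ∫⁻ x, f x = 0 := by
  obtain ⟨i, hi⟩ := Function.ne_iff.1 hv
  simp only [Pi.zero_apply] at hi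
  -- Cut space into slabs that translation by `v` permutes. Their masses are summable, so they tend
  -- to `0` in both directions, and convexity bounds twice the mass of slab `k` by those of slabs `k
  -- ± n`.
  set s : (ι → ℝ) → ℤ := fun x => ⌊x i / v i⌋ with hs
  have hsm : Measurable s := Int.measurable_floor.comp ((measurable_pi_apply i).div_const _)
  set B : ℤ → Set (ι → ℝ) := fun n => s ⁻¹' {n} with hB
  have hBm : ∀ n, MeasurableSet (B n) := fun n => hsm (measurableSet_singleton n)
  have hadd : ∀ x (n : ℤ), s (x + (n : ℝ) • v) = s x + n := by
    intro x n
    simp only [hs, Pi.add_apply, Pi.smul_apply, smul_eq_mul]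
    rw [add_div, mul_div_cancel_right₀ _ hi, Int.floor_add_intCast]
  have htr : ∀ k n : ℤ, ∫⁻ x in B (k + n), f x = ∫⁻ x in B k, f (x + (n : ℝ) • v) := by
    intro k n
    rw [← lintegral_indicator (hBm _), ← lintegral_indicator (hBm _),
      ← lintegral_add_right_eq_self _ ((n : ℝ) • v)]
    refine lintegral_congr fun x => ?_
    have : x + (n : ℝ) • v ∈ B (k + n) ↔ x ∈ B k := by
      simp [hB, hadd]
    by_cases hx : x ∈ B k
    · rw [Set.indicator_of_mem (this.2 hx), Set.indicator_of_mem hx]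
    · rw [Set.indicator_of_notMem (fun h => hx (this.1 h)), Set.indicator_of_notMem hx]
  have htot : ∫⁻ x, f x = ∑' n, ∫⁻ x in B n, f x := by
    rw [← lintegral_iUnion hBm (fun a b hab => Set.disjoint_left.2 fun x hxa hxb =>
      hab ((show s x = a from hxa).symm.trans hxb)), ← Set.preimage_iUnion, Set.iUnion_of_singleton,
      Set.preimage_univ, setLIntegral_univ]
  have hlim : Tendsto (fun n : ℤ => ∫⁻ x in B n, f x) cofinite (𝓝 0) :=
    ENNReal.tendsto_cofinite_zero_of_tsum_ne_top (htot ▸ hfin)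
  rw [htot, ENNReal.tsum_eq_zero]
  intro k
  have hinj1 : Function.Injective fun n : ℕ => k + (n : ℤ) := fun a b h => by simpa using h
  have hinj2 : Function.Injective fun n : ℕ => k + -(n : ℤ) := fun a b h => by simpa using h
  have h1 := hlim.comp hinj1.tendsto_cofinite
  have h2 := hlim.comp hinj2.tendsto_cofinite
  have h3 := h1.add h2
  rw [add_zero] at h3
  have h4 : 2 * ∫⁻ x in B k, f x ≤ 0 := by
    refine ge_of_tendsto' h3 fun n => ?_
    simp only [Function.comp_apply, htr]
    rw [← lintegral_const_mul _ hf, ← lintegral_add_left (by fun_prop)]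
    refine lintegral_mono fun x => ?_
    simpa [sub_eq_add_neg] using hconv x n
  simpa using h4

/-- If `vᵀSv ≤ 0` with `v ≠ 0`, the exponent is convex along `v`, hence so is its exponential; a
finite integral would then vanish, though the integrand is positive. -/
theorem posDef_of_lintegral_ne_top {S : Matrix ι ι ℝ} (hS : S.IsHermitian) {l : ι → ℝ}
    (hfin : ∫⁻ x : ι → ℝ, ENNReal.ofReal (Real.exp (-(x ⬝ᵥ (S *ᵥ x)) + l ⬝ᵥ x)) ≠ ⊤) :
    S.PosDef := by
  refine .of_dotProduct_mulVec_pos hS fun v hv => ?_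
  rw [star_trivial]
  by_contra hneg
  push Not at hneg
  have hm : Measurable fun x : ι → ℝ =>
      ENNReal.ofReal (Real.exp (-(x ⬝ᵥ (S *ᵥ x)) + l ⬝ᵥ x)) := by
    simp only [dotProduct, Matrix.mulVec]
    fun_prop
  have h0 := lintegral_eq_zero_of_midpoint_convex hm hfin hv fun x n => by
    rw [← ENNReal.ofReal_add (Real.exp_pos _).le (Real.exp_pos _).le,
      show (2 : ENNReal) = ENNReal.ofReal 2 by simp, ← ENNReal.ofReal_mul zero_le_two]
    refine ENNReal.ofReal_le_ofReal ?_
    set q := -(x ⬝ᵥ (S *ᵥ x)) + l ⬝ᵥ x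
    set d := -((n : ℝ) * (v ⬝ᵥ (S *ᵥ x)) + (n : ℝ) * (x ⬝ᵥ (S *ᵥ v))) + (n : ℝ) * (l ⬝ᵥ v)
    have e1 : -((x + (n : ℝ) • v) ⬝ᵥ (S *ᵥ (x + (n : ℝ) • v))) + l ⬝ᵥ (x + (n : ℝ) • v) =
        q + d + (n : ℝ) ^ 2 * -(v ⬝ᵥ (S *ᵥ v)) := by
      simp only [Matrix.mulVec_add, Matrix.mulVec_smul, dotProduct_add, add_dotProduct,
        smul_dotProduct, dotProduct_smul, smul_eq_mul, q, d]
      ring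
    have e2 : -((x - (n : ℝ) • v) ⬝ᵥ (S *ᵥ (x - (n : ℝ) • v))) + l ⬝ᵥ (x - (n : ℝ) • v) =
        q - d + (n : ℝ) ^ 2 * -(v ⬝ᵥ (S *ᵥ v)) := by
      simp only [Matrix.mulVec_sub, Matrix.mulVec_smul, dotProduct_sub, sub_dotProduct,
        smul_dotProduct, dotProduct_smul, smul_eq_mul, q, d]
      ring
    have hr : 0 ≤ (n : ℝ) ^ 2 * -(v ⬝ᵥ (S *ᵥ v)) := mul_nonneg (sq_nonneg _) (by linarith)
    rw [e1, e2]
    have h1 : Real.exp (q + d) ≤ Real.exp (q + d + (n : ℝ) ^ 2 * -(v ⬝ᵥ (S *ᵥ v))) :=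
      Real.exp_le_exp.2 (by linarith)
    have h2 : Real.exp (q - d) ≤ Real.exp (q - d + (n : ℝ) ^ 2 * -(v ⬝ᵥ (S *ᵥ v))) :=
      Real.exp_le_exp.2 (by linarith)
    have h3 : 2 * Real.exp q ≤ Real.exp (q + d) + Real.exp (q - d) := by
      clear_value q d
      rw [sub_eq_add_neg, Real.exp_add, Real.exp_add, ← mul_add, mul_comm]
      have := Real.one_le_cosh d
      rw [Real.cosh_eq] at this
      exact mul_le_mul_of_nonneg_left (by linarith) (Real.exp_pos q).le
    linarith
  rw [lintegral_eq_zero_iff hm] at h0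
  obtain ⟨x, hx⟩ := h0.exists
  simp only [Pi.zero_apply, ENNReal.ofReal_eq_zero] at hx
  exact absurd hx (not_le.2 (Real.exp_pos _))

theorem lintegral_exp_neg_sum_sq :
    ∫⁻ x : ι → ℝ, ENNReal.ofReal (Real.exp (-(x ⬝ᵥ x))) =
      ENNReal.ofReal (Real.sqrt Real.pi ^ Fintype.card ι) := by
  have h1 : ∫ x : ι → ℝ, Real.exp (-(x ⬝ᵥ x)) = Real.sqrt Real.pi ^ Fintype.card ι := by
    have : ∀ x : ι → ℝ, Real.exp (-(x ⬝ᵥ x)) = ∏ i, Real.exp (-1 * x i ^ 2) := fun x => by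
      rw [← Real.exp_sum, dotProduct, ← Finset.sum_neg_distrib]
      congr 1
      exact Finset.sum_congr rfl fun i _ => by ring
    simp_rw [this]
    rw [integral_fintype_prod_volume_eq_pow fun x : ℝ => Real.exp (-1 * x ^ 2), integral_gaussian,
      div_one]
  rw [← h1]
  refine (ofReal_integral_eq_lintegral_ofReal ?_ (ae_of_all _ fun x => (Real.exp_pos _).le)).symm
  by_contra hc
  rw [integral_undef hc] at h1
  have : 0 < Real.sqrt Real.pi := Real.sqrt_pos.2 Real.pi_pos
  exact (pow_pos this _).ne h1

theorem lintegral_comp_mulVec [DecidableEq ι] {B : Matrix ι ι ℝ} (hB : B.det ≠ 0)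
    {g : (ι → ℝ) → ENNReal} (hg : Measurable g) :
    ∫⁻ x, g (B *ᵥ x) = ENNReal.ofReal |B.det|⁻¹ * ∫⁻ x, g x := by
  have h := Real.map_matrix_volume_pi_eq_smul_volume_pi hB
  have h2 : Measurable (Matrix.toLin' B) := (LinearMap.continuous_of_finiteDimensional _).measurable
  rw [← abs_inv, ← smul_eq_mul, ← lintegral_smul_measure, ← h, lintegral_map hg h2]
  simp only [Matrix.toLin'_apply]

/-- Complete the square at the critical point `x₀`, then substitute `y = Bx` with `S = BᵀB`. -/
theorem lintegral_exp_neg_quadratic [DecidableEq ι] {S : Matrix ι ι ℝ} (hS : S.PosDef)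
    {l x₀ : ι → ℝ} (hx₀ : (2 : ℝ) • (S *ᵥ x₀) = l) :
    ∫⁻ x : ι → ℝ, ENNReal.ofReal (Real.exp (-(x ⬝ᵥ (S *ᵥ x)) + l ⬝ᵥ x)) =
      ENNReal.ofReal (Real.sqrt (Real.pi ^ Fintype.card ι / S.det) *
        Real.exp (1 / 2 * (l ⬝ᵥ x₀))) := by
  obtain ⟨B, hB⟩ : ∃ B : Matrix ι ι ℝ, S = Bᵀ * B := by
    open scoped MatrixOrder in
    obtain ⟨B, hB⟩ := CStarAlgebra.nonneg_iff_eq_star_mul_self.mp hS.posSemidef.nonneg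
    exact ⟨B, by rw [hB, Matrix.star_eq_conjTranspose, Matrix.conjTranspose_eq_transpose_of_trivial]⟩
  have hdet : S.det = B.det ^ 2 := by rw [hB, Matrix.det_mul, Matrix.det_transpose, sq]
  have hBd : B.det ≠ 0 := fun h => by
    have := hS.det_pos
    rw [hdet, h] at this
    simp at this
  have hsymm : ∀ x y, x ⬝ᵥ (S *ᵥ y) = y ⬝ᵥ (S *ᵥ x) := fun x y => by
    rw [dotProduct_comm, ← Matrix.vecMul_transpose, ← Matrix.dotProduct_mulVec]
    have : Sᵀ = S := by rw [hB]; simp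
    rw [this]
  have hshift : ∀ x, -((x + x₀) ⬝ᵥ (S *ᵥ (x + x₀))) + l ⬝ᵥ (x + x₀) =
      1 / 2 * (l ⬝ᵥ x₀) + -((B *ᵥ x) ⬝ᵥ (B *ᵥ x)) := by
    intro x
    have h1 : (B *ᵥ x) ⬝ᵥ (B *ᵥ x) = x ⬝ᵥ (S *ᵥ x) := by
      rw [hB, ← Matrix.mulVec_mulVec, Matrix.dotProduct_mulVec x, Matrix.vecMul_transpose]
    have h2 : l ⬝ᵥ x = 2 * (x ⬝ᵥ (S *ᵥ x₀)) := by
      rw [← hx₀, smul_dotProduct, smul_eq_mul, dotProduct_comm]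
    have h3 : l ⬝ᵥ x₀ = 2 * (x₀ ⬝ᵥ (S *ᵥ x₀)) := by
      rw [← hx₀, smul_dotProduct, smul_eq_mul, dotProduct_comm]
    rw [h1, Matrix.mulVec_add, dotProduct_add, add_dotProduct, add_dotProduct, dotProduct_add, h2, h3,
      hsymm x₀ x]
    ring
  rw [← lintegral_add_right_eq_self _ x₀]
  simp_rw [hshift, Real.exp_add, ENNReal.ofReal_mul (Real.exp_pos _).le]
  rw [lintegral_const_mul' _ _ ENNReal.ofReal_ne_top,
    lintegral_comp_mulVec hBd (g := fun y => ENNReal.ofReal (Real.exp (-(y ⬝ᵥ y))))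
      (by simp only [dotProduct]; fun_prop), lintegral_exp_neg_sum_sq,
    ← ENNReal.ofReal_mul (by positivity), ← ENNReal.ofReal_mul (Real.exp_pos _).le, mul_comm]
  congr 2
  rw [Real.sqrt_div' _ hS.det_pos.le, hdet, Real.sqrt_sq_eq_abs, div_eq_inv_mul]
  congr 1
  symm
  rw [Real.sqrt_eq_iff_mul_self_eq (by positivity) (by positivity), ← mul_pow,
    Real.mul_self_sqrt Real.pi_pos.le]

end RealGaussian

/-! ### Phase-space coordinates and the matrix `1 - XA` -/

section Phase

variable {m : ℕ}

/-- The complex vector with real parts `x ∘ inl` and imaginary parts `x ∘ inr`. -/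
def phaseToComplex (x : Fin m ⊕ Fin m → ℝ) : Fin m → ℂ :=
  fun i => x (Sum.inl i) + x (Sum.inr i) * Complex.I

theorem measurePreserving_phaseToComplex :
    MeasurePreserving (phaseToComplex (m := m)) volume volume := by
  have h1 := volume_measurePreserving_sumPiEquivProdPi (fun _ : Fin m ⊕ Fin m => ℝ)
  have h2 := (volume_measurePreserving_arrowProdEquivProdArrow ℝ ℝ (Fin m)).symm
  have h3 : MeasurePreserving (fun (a : Fin m → ℝ × ℝ) (i : Fin m) =>
      Complex.measurableEquivRealProd.symm (a i)) volume volume :=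
    volume_preserving_pi fun i => Complex.volume_preserving_equiv_real_prod.symm
  convert (h3.comp h2).comp h1 using 1
  funext x i
  apply Complex.ext <;>
  simp [phaseToComplex, MeasurableEquiv.sumPiEquivProdPi, MeasurableEquiv.arrowProdEquivProdArrow,
    Equiv.sumPiEquivProdPi, Equiv.arrowProdEquivProdArrow, Complex.measurableEquivRealProd]

theorem lintegral_comp_star {f : (Fin m → ℂ) → ENNReal} (hf : Measurable f) :
    ∫⁻ z, f (star z) = ∫⁻ z, f z := by
  have h : MeasurePreserving (fun (z : Fin m → ℂ) (i : Fin m) => Complex.conjLIE (z i))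
      volume volume :=
    volume_preserving_pi fun i => Complex.conjLIE.measurePreserving
  exact h.lintegral_comp hf

/-- The change of variables from position and momentum coordinates to `(z, z̄)`. -/
def phaseU (m : ℕ) : Matrix (Fin m ⊕ Fin m) (Fin m ⊕ Fin m) ℂ :=
  Matrix.fromBlocks 1 (Complex.I • 1) 1 (-(Complex.I • 1))

theorem phaseU_mulVec (x : Fin m ⊕ Fin m → ℝ) :
    phaseU m *ᵥ (fun i => (x i : ℂ)) = Sum.elim (phaseToComplex x) (star (phaseToComplex x)) := by
  have : (fun i => (x i : ℂ)) = Sum.elim (fun i => (x (Sum.inl i) : ℂ)) fun i => (x (Sum.inr i) : ℂ) := by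
    funext i; cases i <;> rfl
  rw [this, phaseU, Matrix.fromBlocks_mulVec]
  congr 1
  · funext i
    simp [phaseToComplex, Matrix.smul_mulVec, mul_comm]
  · funext i
    simp [phaseToComplex, Matrix.smul_mulVec, Matrix.neg_mulVec, mul_comm]

theorem phaseU_conjTranspose_mul : (phaseU m)ᴴ * phaseU m = (2 : ℂ) • 1 := by
  rw [phaseU, Matrix.fromBlocks_conjTranspose, Matrix.fromBlocks_multiply, ← Matrix.fromBlocks_one,
    Matrix.fromBlocks_smul]
  congr 1 <;> simp [smul_smul, two_smul]

theorem phaseU_mul_conjTranspose : phaseU m * (phaseU m)ᴴ = (2 : ℂ) • 1 := by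
  have h : ((2 : ℂ)⁻¹ • (phaseU m)ᴴ) * phaseU m = 1 := by
    rw [Matrix.smul_mul, phaseU_conjTranspose_mul, smul_smul]; norm_num
  have h2 := mul_eq_one_comm.1 h
  rw [Matrix.mul_smul] at h2
  rw [← h2, smul_smul]; norm_num

/-- On the vectors `(z, z̄)` coming from real phase space, the swap acts as complex conjugation;
this is the source of the reality of `phaseS`. -/
theorem swapX_mul_phaseU : swapX m * phaseU m = (phaseU m).map conj := by
  rw [phaseU, swapX, Matrix.fromBlocks_multiply, Matrix.fromBlocks_map]
  congr 1 <;> ext i j <;> by_cases h : i = j <;> simp [h]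

theorem swapX_mul_self : swapX m * swapX m = 1 := by
  rw [swapX, Matrix.fromBlocks_multiply, ← Matrix.fromBlocks_one]
  congr 1 <;> simp

theorem swapX_mul_typeWiseA (Λ Γ : Matrix (Fin m) (Fin m) ℂ) :
    swapX m * typeWiseA Λ Γ = Matrix.fromBlocks Γᵀ Λ Λᴴ Γ := by
  rw [swapX, typeWiseA, Matrix.fromBlocks_multiply]
  congr 1 <;> simp

theorem one_sub_swapX_mul_typeWiseA (Λ Γ : Matrix (Fin m) (Fin m) ℂ) :
    1 - swapX m * typeWiseA Λ Γ = Matrix.fromBlocks (1 - Γᵀ) (-Λ) (-Λᴴ) (1 - Γ) := by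
  rw [swapX_mul_typeWiseA, ← Matrix.fromBlocks_one, sub_eq_add_neg, Matrix.fromBlocks_neg,
    Matrix.fromBlocks_add]
  simp [sub_eq_add_neg]

variable {Λ Γ : Matrix (Fin m) (Fin m) ℂ}

theorem posDef_one_sub_swapX_mul_iff :
    (1 - swapX m * typeWiseA Λ Γ).PosDef ↔
      (1 - Γ).PosDef ∧ ((1 - Γ) - Λᴴ * (1 - Γᵀ)⁻¹ * Λ).PosDef := by
  rw [one_sub_swapX_mul_typeWiseA, ← Matrix.conjTranspose_neg, Matrix.posDef_fromBlocks_iff]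
  have h1 : (1 - Γᵀ) = (1 - Γ)ᵀ := by simp
  simp only [Matrix.conjTranspose_neg, neg_mul, mul_neg, neg_neg]
  rw [h1, Matrix.PosDef.transpose_iff]

theorem swapX_map_conj (hΛ : Λ.IsSymm) (hΓ : Γ.IsHermitian) :
    (1 - swapX m * typeWiseA Λ Γ).map conj =
      swapX m * (1 - swapX m * typeWiseA Λ Γ) * swapX m := by
  have h1 : Γ.map conj = Γᵀ := by
    conv_rhs => rw [← hΓ]
    ext; simp
  have h2 : Γᵀ.map conj = Γ := by
    conv_rhs => rw [← hΓ]
    ext; simp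
  have h3 : Λ.map conj = Λᴴ := by
    conv_lhs => rw [← hΛ]
    ext; simp
  have h4 : Λᴴ.map conj = Λ := by
    rw [← h3]; ext; simp
  rw [one_sub_swapX_mul_typeWiseA, swapX, Matrix.fromBlocks_multiply, Matrix.fromBlocks_multiply,
    Matrix.fromBlocks_map]
  have hs : ∀ P : Matrix (Fin m) (Fin m) ℂ, (1 - P).map conj = 1 - P.map conj := fun P => by
    ext i j; simp [Matrix.one_apply, apply_ite conj]
  have hn : ∀ P : Matrix (Fin m) (Fin m) ℂ, (-P).map conj = - P.map conj := fun P => by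
    ext i j; simp
  rw [hs, hs, hn, hn, h1, h2, h3, h4]
  congr 1 <;> simp

/-- The real quadratic form of the exponent in position and momentum coordinates. -/
def phaseS (Λ Γ : Matrix (Fin m) (Fin m) ℂ) : Matrix (Fin m ⊕ Fin m) (Fin m ⊕ Fin m) ℝ :=
  ((2 : ℂ)⁻¹ • ((phaseU m)ᴴ * (1 - swapX m * typeWiseA Λ Γ) * phaseU m)).map Complex.re

/-- Taking real parts in `phaseS` loses nothing: with `M = 1 - XA`, the relations `Ū = XU`, `M̄ =
XMX` and `X² = 1` make `U†MU` real. -/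
theorem phaseS_map (hΛ : Λ.IsSymm) (hΓ : Γ.IsHermitian) :
    (phaseS Λ Γ).map Complex.ofReal =
      (2 : ℂ)⁻¹ • ((phaseU m)ᴴ * (1 - swapX m * typeWiseA Λ Γ) * phaseU m) := by
  set M := 1 - swapX m * typeWiseA Λ Γ with hM
  have hX : (swapX m).map conj = swapX m := by
    rw [swapX, Matrix.fromBlocks_map]
    congr 1 <;> ext i j <;> simp [Matrix.one_apply, apply_ite conj]
  have hXt : (swapX m)ᴴ = swapX m := by
    rw [swapX, Matrix.fromBlocks_conjTranspose]; simp
  have h0 : ((phaseU m)ᴴ).map conj = (phaseU m)ᴴ * swapX m := by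
    rw [← hXt, ← Matrix.conjTranspose_mul, swapX_mul_phaseU]
    ext; simp
  have h1 : ((phaseU m)ᴴ * M * phaseU m).map conj = (phaseU m)ᴴ * M * phaseU m := by
    rw [Matrix.map_mul, Matrix.map_mul, h0, ← swapX_mul_phaseU, swapX_map_conj hΛ hΓ]
    simp only [Matrix.mul_assoc]
    rw [← Matrix.mul_assoc (swapX m) (swapX m), swapX_mul_self, Matrix.one_mul,
      ← Matrix.mul_assoc (swapX m) (swapX m), swapX_mul_self, Matrix.one_mul]
  ext i j
  have h2 := congrFun (congrFun h1 i) j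
  rw [Matrix.map_apply] at h2
  simp only [phaseS, Matrix.map_apply]
  rw [← Complex.conj_eq_iff_re, Matrix.smul_apply, smul_eq_mul, map_mul, h2, map_inv₀, Complex.conj_ofNat]

theorem one_sub_swapX_mul_isHermitian (hΓ : Γ.IsHermitian) :
    (1 - swapX m * typeWiseA Λ Γ).IsHermitian := by
  rw [one_sub_swapX_mul_typeWiseA, Matrix.IsHermitian, Matrix.fromBlocks_conjTranspose]
  simp [hΓ.eq, hΓ.transpose.eq]

theorem phaseS_isHermitian (hΛ : Λ.IsSymm) (hΓ : Γ.IsHermitian) : (phaseS Λ Γ).IsHermitian := by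
  have h : ((phaseS Λ Γ).map Complex.ofReal)ᴴ = (phaseS Λ Γ).map Complex.ofReal := by
    rw [phaseS_map hΛ hΓ]
    simp only [Matrix.conjTranspose_smul, Matrix.conjTranspose_mul,
      Matrix.conjTranspose_conjTranspose, (one_sub_swapX_mul_isHermitian hΓ).eq, Matrix.mul_assoc]
    simp
  ext i j
  have h1 := congrFun (congrFun h i) j
  simp only [Matrix.conjTranspose_apply, Matrix.map_apply, Complex.star_def, Complex.conj_ofReal,
    Complex.ofReal_inj] at h1
  simpa using h1

theorem phaseS_det (hΛ : Λ.IsSymm) (hΓ : Γ.IsHermitian) :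
    ((phaseS Λ Γ).det : ℂ) = (1 - swapX m * typeWiseA Λ Γ).det := by
  have h := congrArg Matrix.det (phaseS_map hΛ hΓ)
  have h1 : ((phaseS Λ Γ).map Complex.ofReal).det = ((phaseS Λ Γ).det : ℂ) :=
    (RingHom.map_det Complex.ofRealHom _).symm
  rw [← h1, h, ← Matrix.smul_mul, ← Matrix.smul_mul, Matrix.det_mul, Matrix.det_mul, mul_right_comm,
    ← Matrix.det_mul, Matrix.smul_mul, phaseU_conjTranspose_mul, smul_smul]
  norm_num

theorem isUnit_phaseU : IsUnit (phaseU m) := by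
  have h : ((2 : ℂ)⁻¹ • (phaseU m)ᴴ) * phaseU m = 1 := by
    rw [Matrix.smul_mul, phaseU_conjTranspose_mul, smul_smul]; norm_num
  exact ⟨⟨_, _, mul_eq_one_comm.1 h, h⟩, rfl⟩

theorem one_sub_swapX_mul_eq (hΛ : Λ.IsSymm) (hΓ : Γ.IsHermitian) :
    1 - swapX m * typeWiseA Λ Γ =
      (2 : ℂ)⁻¹ • (phaseU m * (phaseS Λ Γ).map Complex.ofReal * star (phaseU m)) := by
  rw [phaseS_map hΛ hΓ, Matrix.star_eq_conjTranspose]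
  simp only [Matrix.mul_smul, Matrix.smul_mul, ← Matrix.mul_assoc]
  rw [phaseU_mul_conjTranspose, Matrix.mul_assoc, phaseU_mul_conjTranspose]
  simp only [Matrix.mul_smul, Matrix.smul_mul, Matrix.one_mul, Matrix.mul_one, smul_smul]
  norm_num

/-- A real factorization `S = BᵀB` with `det S ≠ 0` keeps `S` positive definite over `ℂ`; congruence
by the invertible `U` carries this to `1 - XA`. -/
theorem posDef_of_phaseS_posDef (hΛ : Λ.IsSymm) (hΓ : Γ.IsHermitian) (h : (phaseS Λ Γ).PosDef) :
    (1 - swapX m * typeWiseA Λ Γ).PosDef := by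
  obtain ⟨B, hB⟩ : ∃ B : Matrix (Fin m ⊕ Fin m) (Fin m ⊕ Fin m) ℝ, phaseS Λ Γ = Bᴴ * B := by
    open scoped MatrixOrder in
    exact CStarAlgebra.nonneg_iff_eq_star_mul_self.mp h.posSemidef.nonneg
  have h1 : (phaseS Λ Γ).map Complex.ofReal =
      (B.map Complex.ofReal)ᴴ * B.map Complex.ofReal := by
    have : (B.map Complex.ofReal)ᴴ = Bᴴ.map Complex.ofReal := by ext; simp
    rw [this, hB]
    exact Matrix.map_mul (f := Complex.ofRealHom)
  have h2 : ((phaseS Λ Γ).map Complex.ofReal).PosSemidef := by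
    rw [h1]; exact Matrix.posSemidef_conjTranspose_mul_self _
  have h3 : ((phaseS Λ Γ).map Complex.ofReal).PosDef := by
    rw [h2.posDef_iff_det_ne_zero]
    have : ((phaseS Λ Γ).map Complex.ofReal).det = ((phaseS Λ Γ).det : ℂ) :=
      (RingHom.map_det Complex.ofRealHom _).symm
    rw [this]
    exact_mod_cast h.det_pos.ne'
  rw [one_sub_swapX_mul_eq hΛ hΓ]
  exact ((Matrix.IsUnit.posDef_star_right_conjugate_iff isUnit_phaseU).2 h3).smul (by norm_num)

theorem ofReal_dotProduct {ι : Type*} [Fintype ι] (x y : ι → ℝ) :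
    ((x ⬝ᵥ y : ℝ) : ℂ) = (fun i => (x i : ℂ)) ⬝ᵥ fun i => (y i : ℂ) := by
  simp [dotProduct]

theorem ofReal_mulVec {ι : Type*} [Fintype ι] (S : Matrix ι ι ℝ) (x : ι → ℝ) :
    (fun i => ((S *ᵥ x) i : ℂ)) = S.map Complex.ofReal *ᵥ fun i => (x i : ℂ) := by
  funext i
  simp [Matrix.mulVec, dotProduct]

theorem phaseS_posDef (hΛ : Λ.IsSymm) (hΓ : Γ.IsHermitian)
    (h : (1 - swapX m * typeWiseA Λ Γ).PosDef) : (phaseS Λ Γ).PosDef := by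
  have h1 : ((phaseS Λ Γ).map Complex.ofReal).PosDef := by
    rw [phaseS_map hΛ hΓ]
    exact ((Matrix.IsUnit.posDef_star_left_conjugate_iff isUnit_phaseU).2 h).smul (by norm_num)
  refine .of_dotProduct_mulVec_pos (phaseS_isHermitian hΛ hΓ) fun x hx => ?_
  have h2 := h1.dotProduct_mulVec_pos (x := fun i => (x i : ℂ)) fun hc => hx <| by
    funext i
    simpa using congrFun hc i
  have h3 : star (fun i => (x i : ℂ)) = fun i => (x i : ℂ) := by funext i; simp
  rw [h3, ← ofReal_mulVec, ← ofReal_dotProduct] at h2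
  rw [star_trivial]
  exact_mod_cast h2

/-- The exponent of the Gaussian function at `(z, z̄)`, weighted by the coherent state norms, in
position and momentum coordinates. -/
theorem exponent_eq_phase (hΛ : Λ.IsSymm) (hΓ : Γ.IsHermitian) (β : Fin m → ℂ)
    (x : Fin m ⊕ Fin m → ℝ) :
    1 / 2 * (Sum.elim (phaseToComplex x) (star (phaseToComplex x)) ⬝ᵥ
        (typeWiseA Λ Γ *ᵥ Sum.elim (phaseToComplex x) (star (phaseToComplex x)))) +
      Sum.elim (phaseToComplex x) (star (phaseToComplex x)) ⬝ᵥ Sum.elim (star β) β -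
      sqNorm (phaseToComplex x) =
    ((-(x ⬝ᵥ (phaseS Λ Γ *ᵥ x)) +
      Sum.elim (fun i => 2 * (β i).re) (fun i => 2 * (β i).im) ⬝ᵥ x : ℝ) : ℂ) := by
  set z := phaseToComplex x with hz
  set ζ : Fin m ⊕ Fin m → ℂ := Sum.elim z (star z) with hζ
  have h1 : star ζ ᵥ* swapX m = ζ := by
    rw [swapX, hζ]
    funext i
    cases i <;> simp [Matrix.vecMul, dotProduct, Matrix.one_apply]
  have h2 : star ζ ⬝ᵥ ζ = 2 * sqNorm z := by
    simp only [dotProduct, hζ, sqNorm, Fintype.sum_sum_type, Pi.star_apply, Sum.elim_inl,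
      Sum.elim_inr, Complex.star_def]
    rw [two_mul, Complex.ofReal_sum]
    congr 1 <;> refine Finset.sum_congr rfl fun i _ => ?_
    · rw [← Complex.normSq_eq_conj_mul_self, Complex.normSq_eq_norm_sq]
    · rw [Complex.conj_conj, mul_comm, ← Complex.normSq_eq_conj_mul_self, Complex.normSq_eq_norm_sq]
  have h3 : ((x ⬝ᵥ (phaseS Λ Γ *ᵥ x) : ℝ) : ℂ) =
      1 / 2 * (star ζ ⬝ᵥ ((1 - swapX m * typeWiseA Λ Γ) *ᵥ ζ)) := by
    rw [ofReal_dotProduct, ofReal_mulVec, phaseS_map hΛ hΓ, hζ, ← phaseU_mulVec x,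
      Matrix.star_mulVec, ← Matrix.dotProduct_mulVec, Matrix.mulVec_mulVec, Matrix.mulVec_mulVec,
      Matrix.smul_mulVec, dotProduct_smul]
    have h3 : star (fun i => (x i : ℂ)) = fun i => (x i : ℂ) := by funext i; simp
    rw [h3, smul_eq_mul, one_div]
  have h4 : ζ ⬝ᵥ Sum.elim (star β) β =
      ((Sum.elim (fun i => 2 * (β i).re) (fun i => 2 * (β i).im) ⬝ᵥ x : ℝ) : ℂ) := by
    simp only [dotProduct, hζ, hz, Fintype.sum_sum_type, Sum.elim_inl, Sum.elim_inr,
      Complex.ofReal_add, Complex.ofReal_sum]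
    rw [← Finset.sum_add_distrib, ← Finset.sum_add_distrib]
    refine Finset.sum_congr rfl fun i _ => ?_
    apply Complex.ext <;> simp [phaseToComplex] <;> ring
  rw [Complex.ofReal_add, Complex.ofReal_neg, h3, h4, Matrix.sub_mulVec, dotProduct_sub,
    Matrix.one_mulVec, h2, ← Matrix.mulVec_mulVec, Matrix.dotProduct_mulVec _ (swapX m), h1]
  ring

/-- The Gaussian integral over phase space. -/
theorem lintegral_phaseS (hΛ : Λ.IsSymm) (hΓ : Γ.IsHermitian) (β : Fin m → ℂ)
    (hM : (1 - swapX m * typeWiseA Λ Γ).PosDef) :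
    ∃ D E : ℝ, 0 < D ∧ (D : ℂ) = (1 - swapX m * typeWiseA Λ Γ).det ∧
      (E : ℂ) = 1 / 2 * (Sum.elim (star β) β ⬝ᵥ
        ((1 - swapX m * typeWiseA Λ Γ)⁻¹ *ᵥ star (Sum.elim (star β) β))) ∧
      ∫⁻ x : Fin m ⊕ Fin m → ℝ, ENNReal.ofReal (Real.exp (-(x ⬝ᵥ (phaseS Λ Γ *ᵥ x)) +
        Sum.elim (fun i => 2 * (β i).re) (fun i => 2 * (β i).im) ⬝ᵥ x)) =
      ENNReal.ofReal (Real.pi ^ m / Real.sqrt D * Real.exp E) := by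
  set M := 1 - swapX m * typeWiseA Λ Γ with hMdef
  set b : Fin m ⊕ Fin m → ℂ := Sum.elim (star β) β with hb
  set l : Fin m ⊕ Fin m → ℝ := Sum.elim (fun i => 2 * (β i).re) (fun i => 2 * (β i).im) with hl
  have hS := phaseS_posDef hΛ hΓ hM
  have hSu : IsUnit (phaseS Λ Γ).det := hS.det_pos.ne'.isUnit
  set x₀ : Fin m ⊕ Fin m → ℝ := (2 : ℝ)⁻¹ • ((phaseS Λ Γ)⁻¹ *ᵥ l) with hx₀
  have hSx : (2 : ℝ) • (phaseS Λ Γ *ᵥ x₀) = l := by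
    rw [hx₀, Matrix.mulVec_smul, smul_smul, Matrix.mulVec_mulVec, Matrix.mul_nonsing_inv _ hSu]
    norm_num
  refine ⟨(phaseS Λ Γ).det, 1 / 2 * (l ⬝ᵥ x₀), hS.det_pos, phaseS_det hΛ hΓ, ?_, ?_⟩
  · set y : Fin m ⊕ Fin m → ℂ := fun i => (x₀ i : ℂ) with hy
    have hlU : (fun i => (l i : ℂ)) = b ᵥ* phaseU m := by
      rw [phaseU, hb, hl, Matrix.vecMul_fromBlocks]
      funext i
      cases i <;> apply Complex.ext <;> simp [Matrix.vecMul_smul, Matrix.vecMul_neg] <;> ring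
    have hlU2 : (fun i => (l i : ℂ)) = (phaseU m)ᴴ *ᵥ star b := by
      rw [← Matrix.star_vecMul, ← hlU]
      funext i; simp
    have h1 : (2 : ℂ) • ((phaseS Λ Γ).map Complex.ofReal *ᵥ y) = (phaseU m)ᴴ *ᵥ star b := by
      rw [← hlU2, ← ofReal_mulVec, ← hSx]
      funext i; simp
    -- Multiply `U†MUy = U†b̄` by `U` and use `UU† = 2`. Since `l = bᵀU`, it follows that `½ lᵀx₀ =
    -- ½ bᵀM⁻¹b̄`.
    have h2 : M *ᵥ (phaseU m *ᵥ y) = star b := by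
      have h3 := congrArg (fun v => phaseU m *ᵥ v) h1
      simp only [phaseS_map hΛ hΓ, Matrix.smul_mulVec, smul_smul, Matrix.mulVec_mulVec,
        phaseU_mul_conjTranspose, ← Matrix.mul_assoc, Matrix.mulVec_smul, Matrix.smul_mul,
        Matrix.one_mul, Matrix.one_mulVec] at h3
      norm_num at h3
      rw [Matrix.mulVec_mulVec]
      exact h3
    have hMu : IsUnit M.det := hM.det_pos.ne'.isUnit
    rw [← h2, Matrix.mulVec_mulVec _ M⁻¹, Matrix.nonsing_inv_mul _ hMu, Matrix.one_mulVec,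
      Matrix.dotProduct_mulVec, ← hlU, ← ofReal_dotProduct]
    push_cast; rfl
  · rw [lintegral_exp_neg_quadratic hS hSx]
    congr 2
    rw [Real.sqrt_div' _ hS.det_pos.le]
    congr 1
    rw [Fintype.card_sum, Fintype.card_fin, pow_add, Real.sqrt_mul_self (by positivity)]

end Phase

/-! ### Gaussian Bargmann functions: necessity, then sufficiency -/

section Gaussian

variable {m : ℕ} {Λ Γ : Matrix (Fin m) (Fin m) ℂ}

theorem exponent_elim (Λ Γ : Matrix (Fin m) (Fin m) ℂ) (w z b₁ b₂ : Fin m → ℂ) :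
    1 / 2 * (Sum.elim w z ⬝ᵥ (typeWiseA Λ Γ *ᵥ Sum.elim w z)) + Sum.elim w z ⬝ᵥ Sum.elim b₁ b₂ =
      (1 / 2 * (w ⬝ᵥ (Λᴴ *ᵥ w)) + w ⬝ᵥ b₁) + (1 / 2 * (z ⬝ᵥ (Λ *ᵥ z)) + z ⬝ᵥ b₂) +
        w ⬝ᵥ (Γ *ᵥ z) := by
  have h : z ⬝ᵥ (Γᵀ *ᵥ w) = w ⬝ᵥ (Γ *ᵥ z) := by
    rw [Matrix.mulVec_transpose, dotProduct_comm, ← Matrix.dotProduct_mulVec]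
  rw [typeWiseA, Matrix.fromBlocks_mulVec]
  simp only [sumElim_dotProduct_sumElim, Sum.elim_comp_inl, Sum.elim_comp_inr,
    dotProduct_add, h]
  ring

theorem conj_quadratic (Λ : Matrix (Fin m) (Fin m) ℂ) (hΛ : Λ.IsSymm) (z b : Fin m → ℂ) :
    conj (1 / 2 * (z ⬝ᵥ (Λ *ᵥ z)) + z ⬝ᵥ b) =
      1 / 2 * (star z ⬝ᵥ (Λᴴ *ᵥ star z)) + star z ⬝ᵥ star b := by
  have h : ∀ i j, conj (Λ i j) = conj (Λ j i) := fun i j => by rw [hΛ.apply]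
  simp only [dotProduct, Matrix.mulVec, map_add, map_mul, map_sum, Pi.star_apply, Complex.star_def,
    Matrix.conjTranspose_apply, h, map_div₀, map_one, Complex.conj_ofNat]

theorem gaussianFn_phaseToComplex (hΛ : Λ.IsSymm) (hΓ : Γ.IsHermitian) (β : Fin m → ℂ) (c : ℂ)
    (x : Fin m ⊕ Fin m → ℝ) :
    gaussianFn (typeWiseA Λ Γ) (Sum.elim (star β) β) c
        (Sum.elim (phaseToComplex x) (star (phaseToComplex x))) *
        (Real.exp (-sqNorm (phaseToComplex x)) : ℂ) =
      c * (Real.exp (-(x ⬝ᵥ (phaseS Λ Γ *ᵥ x)) +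
        Sum.elim (fun i => 2 * (β i).re) (fun i => 2 * (β i).im) ⬝ᵥ x) : ℂ) := by
  rw [gaussianFn, mul_assoc, Complex.ofReal_exp, Complex.ofReal_exp, ← Complex.exp_add,
    ← exponent_eq_phase hΛ hΓ β x, Complex.ofReal_neg, sub_eq_add_neg]

theorem continuous_gaussianFn (A : Matrix (Fin m ⊕ Fin m) (Fin m ⊕ Fin m) ℂ)
    (b : Fin m ⊕ Fin m → ℂ) (c : ℂ) :
    Continuous fun z : Fin m → ℂ => gaussianFn A b c (Sum.elim z (star z)) := by
  have h : Continuous fun z : Fin m → ℂ => (Sum.elim z (star z) : Fin m ⊕ Fin m → ℂ) := by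
    refine continuous_pi fun i => ?_
    cases i with
    | inl i => exact continuous_apply i
    | inr i => exact (continuous_apply i).star
  simp only [gaussianFn]
  fun_prop

theorem lintegral_gaussianFn (hΛ : Λ.IsSymm) (hΓ : Γ.IsHermitian) (β : Fin m → ℂ) {r : ℝ}
    (hr : 0 ≤ r) :
    ∫⁻ z : Fin m → ℂ, ENNReal.ofReal ((gaussianFn (typeWiseA Λ Γ) (Sum.elim (star β) β) r
        (Sum.elim z (star z))).re * Real.exp (-sqNorm z)) =
      ENNReal.ofReal r * ∫⁻ x : Fin m ⊕ Fin m → ℝ, ENNReal.ofReal (Real.exp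
        (-(x ⬝ᵥ (phaseS Λ Γ *ᵥ x)) +
          Sum.elim (fun i => 2 * (β i).re) (fun i => 2 * (β i).im) ⬝ᵥ x)) := by
  have hc : Continuous fun z : Fin m → ℂ => ENNReal.ofReal
      ((gaussianFn (typeWiseA Λ Γ) (Sum.elim (star β) β) r (Sum.elim z (star z))).re *
        Real.exp (-sqNorm z)) := by
    have := continuous_gaussianFn (typeWiseA Λ Γ) (Sum.elim (star β) β) r
    simp only [sqNorm]
    exact ENNReal.continuous_ofReal.comp
      ((Complex.continuous_re.comp this).mul (by fun_prop))
  rw [← measurePreserving_phaseToComplex.lintegral_comp hc.measurable,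
    ← lintegral_const_mul' _ _ ENNReal.ofReal_ne_top]
  refine lintegral_congr fun x => ?_
  rw [← ENNReal.ofReal_mul hr]
  congr 1
  have h := congrArg Complex.re (gaussianFn_phaseToComplex hΛ hΓ β r x)
  rwa [Complex.re_mul_ofReal, ← Complex.ofReal_mul, Complex.ofReal_re] at h

theorem normalization_eq {b : Fin m ⊕ Fin m → ℂ} {D E : ℝ} (hD : 0 < D)
    (hDM : (D : ℂ) = (1 - swapX m * typeWiseA Λ Γ).det)
    (hE : (E : ℂ) = 1 / 2 * (b ⬝ᵥ ((1 - swapX m * typeWiseA Λ Γ)⁻¹ *ᵥ star b))) :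
    Complex.sqrt (1 - swapX m * typeWiseA Λ Γ).det *
        Complex.exp (-(1 / 2) * (b ⬝ᵥ ((1 - swapX m * typeWiseA Λ Γ)⁻¹ *ᵥ star b))) =
      ((Real.sqrt D * Real.exp (-E) : ℝ) : ℂ) := by
  rw [← hDM, Complex.sqrt_of_nonneg (by exact_mod_cast hD.le), Complex.ofReal_re, neg_mul, ← hE]
  push_cast
  rfl

theorem lintegral_gaussianFn_eq_iff {D E r : ℝ} (hD : 0 < D) (hr : 0 ≤ r) :
    ENNReal.ofReal r * ENNReal.ofReal (Real.pi ^ m / Real.sqrt D * Real.exp E) =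
      ENNReal.ofReal (Real.pi ^ m) ↔ r = Real.sqrt D * Real.exp (-E) := by
  have hs : 0 < Real.sqrt D := Real.sqrt_pos.2 hD
  have hp : 0 < Real.pi ^ m := pow_pos Real.pi_pos m
  have he := Real.exp_pos E
  rw [← ENNReal.ofReal_mul hr, ENNReal.ofReal_eq_ofReal_iff (by positivity) hp.le, Real.exp_neg]
  constructor
  · intro h
    field_simp at h ⊢
    linarith
  · rintro rfl
    field_simp

theorem conj_bargmann {ρ : Fock m →L[ℂ] Fock m} (hρ : ρ.IsPositive) (w z : Fin m → ℂ) :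
    conj (bargmann ρ (Sum.elim w z)) = bargmann ρ (Sum.elim (star z) (star w)) := by
  simp only [bargmann, Sum.elim_comp_inl, Sum.elim_comp_inr, map_mul, Complex.conj_ofReal, star_star,
    sqNorm_star, inner_conj_symm]
  rw [hρ.inner_left_eq_inner_right, add_comm]

/-- The Cauchy-Schwarz inequality for the Bargmann function, against the vacuum. -/
theorem bargmann_cauchySchwarz {ρ : Fock m →L[ℂ] Fock m} (hρ : ρ.IsPositive) (w : Fin m → ℂ) {h : ℂ}
    (hh : bargmann ρ (Sum.elim w 0) = h * bargmann ρ (Sum.elim 0 0)) :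
    h * conj h * bargmann ρ (Sum.elim 0 0) ≤ bargmann ρ (Sum.elim w (star w)) := by
  set e : (Fin m → ℂ) → Fock m := fun w => (Real.exp (sqNorm w / 2) : ℂ) • coherentState w with he
  have hb : ∀ w z, inner ℂ (e (star z)) (ρ (e w)) = bargmann ρ (Sum.elim w z) := by
    intro w z
    simp only [he, map_smul, inner_smul_left, inner_smul_right, Complex.conj_ofReal, bargmann,
      Sum.elim_comp_inl, Sum.elim_comp_inr, sqNorm_star]
    rw [← mul_assoc, ← Complex.ofReal_mul, ← Real.exp_add, ← add_div,
      add_comm (sqNorm w)]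
  have h1 : inner ℂ (e w) (ρ (e w)) = bargmann ρ (Sum.elim w (star w)) := by
    rw [← hb, star_star]
  have h2 : inner ℂ (e 0) (ρ (e w)) = h * bargmann ρ (Sum.elim 0 0) := by
    rw [← hh, ← hb, star_zero]
  have h3 : inner ℂ (e 0) (ρ (e 0)) = bargmann ρ (Sum.elim 0 0) := by
    rw [← hb, star_zero]
  have h4 : inner ℂ (e w) (ρ (e 0)) = conj h * bargmann ρ (Sum.elim 0 0) := by
    rw [← hρ.inner_left_eq_inner_right, ← inner_conj_symm, h2, map_mul, conj_bargmann hρ]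
    simp
  clear_value e
  -- `h` is the coefficient of the projection of `e w` on `e 0` for the form defined by ρ, so
  -- positivity on the remainder is Cauchy-Schwarz without a division.
  have h5 := hρ.inner_nonneg_right (e w - h • e 0)
  rw [map_sub, map_smul, inner_sub_left, inner_sub_right, inner_sub_right, inner_smul_left,
    inner_smul_right, inner_smul_right, inner_smul_left, h1, h2, h3, h4] at h5
  rw [← sub_nonneg]
  convert h5 using 1
  ring

/-- Equal exponentials determine exponents only modulo `2πi`; letting `t` vary removes the
ambiguity. -/
theorem eq_zero_of_exp_mul_eq_one {a : ℂ} (h : ∀ t : ℂ, Complex.exp (t * a) = 1) : a = 0 := by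
  by_contra ha
  have h1 := congrArg norm (h a⁻¹)
  rw [inv_mul_cancel₀ ha, Complex.norm_exp, norm_one, Complex.one_re, Real.exp_eq_one_iff] at h1
  exact one_ne_zero h1

theorem hermitian_of_representsDensityOperator (hΛ : Λ.IsSymm) {b₁ b₂ : Fin m → ℂ} {c : ℂ}
    (hc : 0 < c) {ρ : Fock m →L[ℂ] Fock m} (hρ : ρ.IsPositive)
    (hF : bargmann ρ = gaussianFn (typeWiseA Λ Γ) (Sum.elim b₁ b₂) c) :
    b₁ = star b₂ ∧ Γ.IsHermitian := by
  have hcc : conj c = c := Complex.conj_eq_iff_im.2 (Complex.pos_iff.1 hc).2.symm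
  have hΛ2 : Λᴴ.IsSymm := hΛ.conjTranspose
  -- This is `conj F(w, z) = F(z̄, w̄)` after the Λ-terms cancel. Taking `v = 0` isolates the linear
  -- part, then unit vectors isolate the entries of `Γ̄ - Γᵀ`.
  have key : ∀ u v : Fin m → ℂ, Complex.exp (u ⬝ᵥ (star b₁ - b₂) + v ⬝ᵥ (star b₂ - b₁) +
      u ⬝ᵥ ((Γ.map conj - Γᵀ) *ᵥ v)) = 1 := by
    intro u v
    have h1 := conj_bargmann hρ (star u) (star v)
    rw [hF, gaussianFn, gaussianFn, exponent_elim, exponent_elim, star_star, star_star, map_mul, hcc,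
      ← Complex.exp_conj, map_add, map_add, conj_quadratic _ hΛ, conj_quadratic _ hΛ2, star_star,
      star_star, Matrix.conjTranspose_conjTranspose] at h1
    have h2 : conj (star u ⬝ᵥ (Γ *ᵥ star v)) = u ⬝ᵥ (Γ.map conj *ᵥ v) := by
      simp [dotProduct, Matrix.mulVec]
    have h3 : v ⬝ᵥ (Γ *ᵥ u) = u ⬝ᵥ (Γᵀ *ᵥ v) := by
      rw [Matrix.mulVec_transpose, dotProduct_comm u, ← Matrix.dotProduct_mulVec]
    rw [h2, h3] at h1
    have h4 := mul_left_cancel₀ hc.ne' h1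
    rw [Matrix.sub_mulVec, dotProduct_sub, dotProduct_sub, dotProduct_sub]
    have h5 := congrArg (fun x => x * (Complex.exp (1 / 2 * (v ⬝ᵥ (Λᴴ *ᵥ v)) + v ⬝ᵥ b₁ +
      (1 / 2 * (u ⬝ᵥ (Λ *ᵥ u)) + u ⬝ᵥ b₂) + u ⬝ᵥ (Γᵀ *ᵥ v)))⁻¹) h4
    simp only [mul_inv_cancel₀ (Complex.exp_ne_zero _)] at h5
    rw [← Complex.exp_neg, ← Complex.exp_add] at h5
    rw [← h5]
    congr 1
    ring
  have hb : star b₁ - b₂ = 0 := by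
    funext i
    refine eq_zero_of_exp_mul_eq_one fun t => ?_
    simpa [mul_sub] using key (Pi.single i t) 0
  have hb' : b₁ = star b₂ := by
    rw [← sub_eq_zero.1 hb, star_star]
  refine ⟨hb', ?_⟩
  have hK : Γ.map conj - Γᵀ = 0 := by
    ext i j
    refine eq_zero_of_exp_mul_eq_one fun t => ?_
    have h := key (Pi.single i t) (Pi.single j 1)
    rw [hb, hb'] at h
    simpa using h
  ext i j
  have h := congrFun (congrFun hK j) i
  simp only [Matrix.sub_apply, Matrix.map_apply, Matrix.transpose_apply, Matrix.zero_apply] at h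
  rw [Matrix.conjTranspose_apply]
  exact sub_eq_zero.1 h

theorem posSemidef_of_representsDensityOperator (hΛ : Λ.IsSymm) (hΓ : Γ.IsHermitian)
    {β : Fin m → ℂ} {c : ℂ} (hc : 0 < c) {ρ : Fock m →L[ℂ] Fock m} (hρ : ρ.IsPositive)
    (hF : bargmann ρ = gaussianFn (typeWiseA Λ Γ) (Sum.elim (star β) β) c) : Γ.PosSemidef := by
  refine .of_dotProduct_mulVec_nonneg hΓ fun x => ?_
  have h0 : bargmann ρ (Sum.elim 0 0) = c := by
    rw [hF, gaussianFn, exponent_elim]; simp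
  have hs := conj_quadratic Λ hΛ x β
  set s := 1 / 2 * (x ⬝ᵥ (Λ *ᵥ x)) + x ⬝ᵥ β with hsdef
  -- Both sides contain the factor `c exp(s + s̄)` from Λ and β; cancelling it leaves `1 ≤
  -- exp(x†Γx)`.
  have h1 := bargmann_cauchySchwarz hρ (star x) (h := Complex.exp (conj s)) (by
    rw [h0, hF, gaussianFn, exponent_elim, hs]
    simp [mul_comm])
  rw [h0, hF, gaussianFn, star_star, exponent_elim, ← hs, ← hsdef, ← Complex.exp_conj,
    Complex.conj_conj, ← Complex.exp_add, Complex.exp_add (conj s + s), mul_comm,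
    ← mul_assoc] at h1
  have ha : ((star x ⬝ᵥ (Γ *ᵥ x)).re : ℂ) = star x ⬝ᵥ (Γ *ᵥ x) :=
    Complex.conj_eq_iff_re.1 (Complex.conj_eq_iff_im.2 (hΓ.im_star_dotProduct_mulVec_self x))
  set a := (star x ⬝ᵥ (Γ *ᵥ x)).re
  have hcr : (c.re : ℂ) = c :=
    Complex.conj_eq_iff_re.1 (Complex.conj_eq_iff_im.2 (Complex.pos_iff.1 hc).2.symm)
  have hk : Complex.exp (conj s + s) = ((Real.exp (2 * s.re) : ℝ) : ℂ) := by
    rw [Complex.ofReal_exp, add_comm, Complex.add_conj]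
  rw [hk, ← ha, ← hcr, ← Complex.ofReal_exp, ← Complex.ofReal_mul, ← Complex.ofReal_mul,
    Complex.real_le_real] at h1
  have hpos : 0 < c.re * Real.exp (2 * s.re) := mul_pos (Complex.pos_iff.1 hc).1 (Real.exp_pos _)
  rw [← ha]
  have h2 : 1 ≤ Real.exp a := le_of_mul_le_mul_left (by linarith) hpos
  exact_mod_cast Real.one_le_exp_iff.1 h2

theorem conditions_of_representsDensityOperator (hΛ : Λ.IsSymm) {b : Fin m ⊕ Fin m → ℂ} {c : ℂ}
    (h : RepresentsDensityOperator (gaussianFn (typeWiseA Λ Γ) b c)) :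
    ∃ β : Fin m → ℂ, b = Sum.elim (star β) β ∧ Γ.PosSemidef ∧
      (1 - swapX m * typeWiseA Λ Γ).PosDef ∧
      c = Complex.sqrt (1 - swapX m * typeWiseA Λ Γ).det *
        Complex.exp (-(1 / 2) *
          (b ⬝ᵥ ((1 - swapX m * typeWiseA Λ Γ)⁻¹ *ᵥ star b))) := by
  obtain ⟨ρ, hρ, hF⟩ := h
  have hpi : ENNReal.ofReal (Real.pi ^ m) ≠ 0 := by
    rw [Ne, ENNReal.ofReal_eq_zero, not_le]
    exact pow_pos Real.pi_pos m
  have htr := hρ.lintegral_bargmann (by rw [hF]; exact continuous_gaussianFn _ _ _)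
  rw [hF] at htr
  have h0 : 0 ≤ c := by
    have h1 := bargmann_star_nonneg hρ.isPositive 0
    rw [hF, gaussianFn] at h1
    simpa using h1
  have hc : 0 < c := by
    refine lt_of_le_of_ne h0 fun hc => hpi ?_
    rw [← htr, ← hc]
    simp [gaussianFn]
  have hb : b = Sum.elim (b ∘ Sum.inl) (b ∘ Sum.inr) := (Sum.elim_comp_inl_inr b).symm
  set β := b ∘ Sum.inr
  rw [hb] at hF
  obtain ⟨hb1, hΓ⟩ := hermitian_of_representsDensityOperator hΛ hc hρ.isPositive hF
  rw [hb1] at hb hF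
  rw [hb] at htr
  have hcr : (c.re : ℂ) = c :=
    Complex.conj_eq_iff_re.1 (Complex.conj_eq_iff_im.2 (Complex.pos_iff.1 hc).2.symm)
  have hr := (Complex.pos_iff.1 hc).1
  rw [← hcr, lintegral_gaussianFn hΛ hΓ β hr.le] at htr
  have hS : (phaseS Λ Γ).PosDef := by
    refine posDef_of_lintegral_ne_top (phaseS_isHermitian hΛ hΓ)
      (l := Sum.elim (fun i => 2 * (β i).re) (fun i => 2 * (β i).im)) fun htop => ?_
    -- As `c > 0`, an infinite Gaussian integral would make the trace integral infinite rather than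
    -- `πᵐ`.
    rw [htop, ENNReal.mul_top (by simpa using hr)] at htr
    exact ENNReal.ofReal_ne_top htr.symm
  have hM := posDef_of_phaseS_posDef hΛ hΓ hS
  obtain ⟨D, E, hD, hDM, hE, hint⟩ := lintegral_phaseS hΛ hΓ β hM
  rw [hint, lintegral_gaussianFn_eq_iff hD hr.le] at htr
  refine ⟨β, hb, posSemidef_of_representsDensityOperator hΛ hΓ hc hρ.isPositive hF, hM, ?_⟩
  rw [hb, normalization_eq hD hDM hE, ← htr, hcr]

theorem hasSum_of_tsum_ofReal {ι : Type*} {a : ι → ℝ} {p : ℝ} (ha : ∀ i, 0 ≤ a i) (hp : 0 ≤ p)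
    (h : ∑' i, ENNReal.ofReal (a i) = ENNReal.ofReal p) : HasSum a p := by
  have h1 : ∑' i, ENNReal.ofReal (a i) ≠ ⊤ := h ▸ ENNReal.ofReal_ne_top
  have h2 := (ENNReal.summable_toReal h1).hasSum
  rw [← ENNReal.tsum_toReal_eq fun i => ENNReal.ofReal_ne_top, h, ENNReal.toReal_ofReal hp] at h2
  simpa only [ENNReal.toReal_ofReal (ha _)] using h2

/-- The Bargmann functions of the unnormalized pure states whose mixture is the Gaussian state. -/
def pureFactor (Λ B : Matrix (Fin m) (Fin m) ℂ) (β : Fin m → ℂ) (r : ℝ) (l : Fin m → ℕ)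
    (z : Fin m → ℂ) : ℂ :=
  (Real.sqrt r : ℂ) * (Complex.exp (1 / 2 * (z ⬝ᵥ (Λ *ᵥ z)) + z ⬝ᵥ β) *
    ∏ i, (B *ᵥ z) i ^ l i * ((Real.sqrt ((l i).factorial : ℝ) : ℂ))⁻¹)

theorem exists_hasEntireSeries_pureFactor (Λ B : Matrix (Fin m) (Fin m) ℂ) (β : Fin m → ℂ) (r : ℝ)
    (l : Fin m → ℕ) : ∃ a, HasEntireSeries a (pureFactor Λ B β r l) := by
  refine hasEntireSeries_mul (hasEntireSeries_const _) (hasEntireSeries_mul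
    (hasEntireSeries_exp_quadratic Λ β) (hasEntireSeries_prod _ fun i _ => hasEntireSeries_mul ?_
      (hasEntireSeries_const _)))
  have h := hasEntireSeries_prod (Finset.range (l i))
    (g := fun _ z => ∑ j, B i j * z j) fun x _ => hasEntireSeries_linear (m := m) (B i)
  simp only [Finset.prod_const, Finset.card_range] at h
  exact h

theorem continuous_pureFactor (Λ B : Matrix (Fin m) (Fin m) ℂ) (β : Fin m → ℂ) (r : ℝ)
    (l : Fin m → ℕ) : Continuous (pureFactor Λ B β r l) := by
  unfold pureFactor
  simp only [dotProduct, Matrix.mulVec]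
  fun_prop

theorem hasSum_pureFactor (hΛ : Λ.IsSymm) {B : Matrix (Fin m) (Fin m) ℂ} (β : Fin m → ℂ) {r : ℝ}
    (hr : 0 ≤ r) (w z : Fin m → ℂ) :
    HasSum (fun l => pureFactor Λ B β r l z * conj (pureFactor Λ B β r l (star w)))
      (gaussianFn (typeWiseA Λ (Bᴴ * B)) (Sum.elim (star β) β) r (Sum.elim w z)) := by
  have h1 := (hasSum_prod_pow_div_factorial fun i => (B *ᵥ z) i * conj ((B *ᵥ star w) i)).mul_left
    ((r : ℂ) * (Complex.exp (1 / 2 * (z ⬝ᵥ (Λ *ᵥ z)) + z ⬝ᵥ β) *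
      Complex.exp (1 / 2 * (w ⬝ᵥ (Λᴴ *ᵥ w)) + w ⬝ᵥ star β)))
  -- The coupling term is an inner product of `Bw̄` and `Bz`, so its exponential series splits into
  -- a sum of products of a function of `z` and a conjugated function of `w̄`.
  have h2 : ∑ i, (B *ᵥ z) i * conj ((B *ᵥ star w) i) = w ⬝ᵥ ((Bᴴ * B) *ᵥ z) := by
    rw [← Matrix.mulVec_mulVec, Matrix.dotProduct_mulVec w, ← star_star w, ← Matrix.star_mulVec,
      dotProduct_comm]
    simp [dotProduct]
  rw [h2, mul_assoc, ← Complex.exp_add, ← Complex.exp_add] at h1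
  rw [gaussianFn, exponent_elim, add_comm (1 / 2 * (w ⬝ᵥ _) + _)]
  refine h1.congr_fun fun l => ?_
  rw [Complex.exp_add, pureFactor, pureFactor]
  simp only [map_mul, Complex.conj_ofReal, ← Complex.exp_conj, conj_quadratic Λ hΛ, star_star,
    map_prod, map_inv₀, map_pow]
  have h3 : (r : ℂ) = (Real.sqrt r : ℂ) * Real.sqrt r := by
    rw [← Complex.ofReal_mul, Real.mul_self_sqrt hr]
  have h4 : ∏ i, ((B *ᵥ z) i * conj ((B *ᵥ star w) i)) ^ l i / ((l i).factorial : ℂ) =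
      (∏ i, (B *ᵥ z) i ^ l i * ((Real.sqrt ((l i).factorial : ℝ) : ℂ))⁻¹) *
      ∏ i, conj ((B *ᵥ star w) i) ^ l i * ((Real.sqrt ((l i).factorial : ℝ) : ℂ))⁻¹ := by
    rw [← Finset.prod_mul_distrib]
    refine Finset.prod_congr rfl fun i _ => ?_
    have h5 : ((l i).factorial : ℂ) =
        (Real.sqrt ((l i).factorial : ℝ) : ℂ) * Real.sqrt ((l i).factorial : ℝ) := by
      rw [← Complex.ofReal_mul, Real.mul_self_sqrt (by positivity)]; simp
    conv_lhs => rw [h5]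
    rw [mul_pow, div_eq_mul_inv, mul_inv]
    ring
  rw [h4]
  conv_rhs => rw [h3]
  ring

theorem representsDensityOperator_gaussianFn (hΛ : Λ.IsSymm) (hΓ : Γ.PosSemidef) (β : Fin m → ℂ)
    {r : ℝ} (hr : 0 ≤ r)
    (hint : ∫⁻ z : Fin m → ℂ, ENNReal.ofReal
      ((gaussianFn (typeWiseA Λ Γ) (Sum.elim (star β) β) r (Sum.elim z (star z))).re *
        Real.exp (-sqNorm z)) = ENNReal.ofReal (Real.pi ^ m)) :
    RepresentsDensityOperator (gaussianFn (typeWiseA Λ Γ) (Sum.elim (star β) β) r) := by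
  obtain ⟨B, rfl⟩ : ∃ B : Matrix (Fin m) (Fin m) ℂ, Γ = Bᴴ * B := by
    open scoped MatrixOrder in
    exact CStarAlgebra.nonneg_iff_eq_star_mul_self.mp hΓ.nonneg
  set g := pureFactor Λ B β r with hg
  have hgc : ∀ l, Continuous (g l) := continuous_pureFactor Λ B β r
  have hmeas : ∀ l, Measurable fun z => ENNReal.ofReal (‖g l z‖ ^ 2 * Real.exp (-sqNorm z)) := by
    intro l
    have := hgc l
    simp only [sqNorm]
    exact (ENNReal.continuous_ofReal.comp (by fun_prop)).measurable
  have htot : ∑' l, ∫⁻ z, ENNReal.ofReal (‖g l z‖ ^ 2 * Real.exp (-sqNorm z)) =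
      ENNReal.ofReal (Real.pi ^ m) := by
    -- At `(w, z) = (z, z̄)` the factors are evaluated at `z̄`, hence the change of variable by
    -- conjugation.
    rw [← lintegral_tsum fun l => (hmeas l).aemeasurable,
      ← lintegral_comp_star (Measurable.tsum fun l => hmeas l), ← hint]
    refine lintegral_congr fun z => ?_
    have h1 := hasSum_pureFactor hΛ (B := B) β hr z (star z)
    have h2 : HasSum (fun l => ‖g l (star z)‖ ^ 2 * Real.exp (-sqNorm z))
        ((gaussianFn (typeWiseA Λ (Bᴴ * B)) (Sum.elim (star β) β) r (Sum.elim z (star z))).re *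
          Real.exp (-sqNorm z)) := by
      refine ((Complex.reCLM.hasSum h1).mul_right _).congr_fun fun l => ?_
      rw [← hg, Complex.mul_conj, Complex.normSq_eq_norm_sq]
      rfl
    rw [← h2.tsum_eq, ENNReal.ofReal_tsum_of_nonneg (fun l => by positivity) h2.summable]
    simp_rw [sqNorm_star]
  have hfin : ∀ l, ∫⁻ z, ENNReal.ofReal (‖g l z‖ ^ 2 * Real.exp (-sqNorm z)) ≠ ⊤ := fun l =>
    ne_top_of_le_ne_top (htot ▸ ENNReal.ofReal_ne_top) (ENNReal.le_tsum l)
  have hex : ∀ l, ∃ φ : Fock m, (∀ z, inner ℂ (coherentState (star z)) φ =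
      (Real.exp (-(sqNorm z) / 2) : ℂ) * g l z) ∧
      ENNReal.ofReal (‖φ‖ ^ 2 * Real.pi ^ m) =
        ∫⁻ z : Fin m → ℂ, ENNReal.ofReal (‖g l z‖ ^ 2 * Real.exp (-sqNorm z)) := fun l => by
    obtain ⟨a, ha⟩ := exists_hasEntireSeries_pureFactor Λ B β r l
    exact exists_fock_of_hasEntireSeries ha (hgc l) (hfin l)
  choose φ hφ hφn using hex
  have hnorm : HasSum (fun l => ‖φ l‖ ^ 2) 1 := by
    have h1 : HasSum (fun l => ‖φ l‖ ^ 2 * Real.pi ^ m) (1 * Real.pi ^ m) := by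
      rw [one_mul]
      refine hasSum_of_tsum_ofReal (fun l => by positivity) (by positivity) ?_
      simp_rw [hφn]
      exact htot
    exact (hasSum_mul_right_iff (pow_pos Real.pi_pos m).ne').1 h1
  obtain ⟨ρ, hρ, hin⟩ := exists_isDensityOperator_of_hasSum φ hnorm
  refine ⟨ρ, hρ, ?_⟩
  funext ζ
  rw [← Sum.elim_comp_inl_inr ζ]
  set w := ζ ∘ Sum.inl
  set z := ζ ∘ Sum.inr
  have h1 := (hin (coherentState (star z)) (coherentState w)).mul_left
    (Real.exp ((sqNorm w + sqNorm z) / 2) : ℂ)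
  refine h1.unique ((hasSum_pureFactor hΛ (B := B) β hr w z).congr_fun fun l => ?_)
  have h2 := hφ l (star w)
  rw [star_star, sqNorm_star] at h2
  rw [hφ, ← inner_conj_symm (φ l), h2, map_mul, Complex.conj_ofReal]
  linear_combination (g l z * conj (g l (star w))) * exp_mul_exp_neg_half (sqNorm w) (sqNorm z)

end Gaussian

end BosonicModes

end

/-! ### The characterization of Gaussian density operators -/

theorem mainTheorem9 (m : ℕ) (Λ Γ : Matrix (Fin m) (Fin m) ℂ) (hΛ : Λ.IsSymm)
    (b : Fin m ⊕ Fin m → ℂ) (c : ℂ) :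
    BosonicModes.RepresentsDensityOperator
        (BosonicModes.gaussianFn (BosonicModes.typeWiseA Λ Γ) b c) ↔
      (∃ β : Fin m → ℂ, b = Sum.elim (star β) β) ∧
      (Γ.PosSemidef ∧ (1 - Γ).PosDef) ∧
      ((1 - Γ) - Λᴴ * (1 - Γᵀ)⁻¹ * Λ).PosDef ∧
      c = Complex.sqrt (1 - BosonicModes.swapX m * BosonicModes.typeWiseA Λ Γ).det *
        Complex.exp (-(1 / 2) *
          (b ⬝ᵥ ((1 - BosonicModes.swapX m * BosonicModes.typeWiseA Λ Γ)⁻¹ *ᵥ star b))) := by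
  constructor
  · intro h
    obtain ⟨β, hb, hΓ, hM, hc⟩ := BosonicModes.conditions_of_representsDensityOperator hΛ h
    obtain ⟨h1, h2⟩ := BosonicModes.posDef_one_sub_swapX_mul_iff.1 hM
    exact ⟨⟨β, hb⟩, ⟨hΓ, h1⟩, h2, hc⟩
  · rintro ⟨⟨β, rfl⟩, ⟨hΓ, h1⟩, h2, hc⟩
    have hM := BosonicModes.posDef_one_sub_swapX_mul_iff.2 ⟨h1, h2⟩
    obtain ⟨D, E, hD, hDM, hE, hint⟩ := BosonicModes.lintegral_phaseS hΛ hΓ.1 β hM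
    rw [BosonicModes.normalization_eq hD hDM hE] at hc
    have hr : 0 ≤ Real.sqrt D * Real.exp (-E) := by positivity
    rw [hc]
    refine BosonicModes.representsDensityOperator_gaussianFn hΛ hΓ β hr ?_
    rw [BosonicModes.lintegral_gaussianFn hΛ hΓ.1 β hr, hint,
      BosonicModes.lintegral_gaussianFn_eq_iff hD hr]
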